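/- Let $p$ be an odd prime and let $P$ be a finite metacyclic $p$-group, that is, a finite $p$-group with a cyclic normal subgroup $N$ such that $P/N$ is cyclic. Let $\mathcal{F}$ be a saturated fusion system on $P$. Then $\mathcal{F}=\mathrm{N}_{\mathcal{F}}(P)$; that is, every morphism $\phi\colon Q\to R$ in $\mathcal{F}$ between subgroups $Q,R\le P$ extends to an automorphism of $P$ that lies in $\mathcal{F}$. In other words, $P$ is resistant: for every saturated fusion system $\mathcal{F}$ on $P$ there is a group $A\le\mathrm{Aut}(P)$ of order prime to $p$ such that $\mathcal{F}=\mathcal{F}_P(P\rtimes A)$, i.e. the morphisms $Q\to R$ in $\mathcal{F}$ are exactly the maps induced by conjugation by elements of $P\rtimes A$. Here a fusion system on $P$ is a category whose objects are the subgroups of $P$ and whose morphisms are injective group homomorphisms, containing all maps between subgroups induced by conjugation in $P$, and closed under restricting the codomain to the image and under inverting isomorphisms. Subgroups isomorphic in $\mathcal{F}$ are called $\mathcal{F}$-conjugate; $Q$ is fully normalized (fully centralized) if $|\mathrm{N}_P(R)|\le|\mathrm{N}_P(Q)|$ (respectively $|\mathrm{C}_P(R)|\le|\mathrm{C}_P(Q)|$)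 for all $R$ that are $\mathcal{F}$-conjugate to $Q$. $\mathcal{F}$ is saturated if (i) every fully normalized $Q$ is fully centralized and $\mathrm{Aut}_P(Q)$, the group of automorphisms of $Q$ induced by conjugation by elements of $\mathrm{N}_P(Q)$, is a Sylow $p$-subgroup of $\mathrm{Aut}_{\mathcal{F}}(Q)$; and (ii) every morphism $\phi\colon Q\to P$ in $\mathcal{F}$ with fully centralized image extends to a morphism $N_\phi\to P$ in $\mathcal{F}$, where $N_\phi$ is the group of all $g\in\mathrm{N}_P(Q)$ for which there is $h\in\mathrm{N}_P(\phi(Q))$ with $\phi(gug^{-1})=h\phi(u)h^{-1}$ for all $u\in Q$. -/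

import Mathlib

/-- A fusion system on a group `P`: a category whose objects are the subgroups of `P`, whose
morphisms are injective group homomorphisms (composed as maps), which contains all maps induced
by conjugation in `P` (in particular identities and inclusions), such that every morphism
restricts to a morphism onto its image, and the inverse of a bijective morphism is a morphism. -/
@[ext]
structure FusionSystem (P : Type*) [Group P] where
  /-- `hom Q R` is the set of morphisms from `Q` to `R`. -/
  hom : (Q R : Subgroup P) → Set (Q →* R)
  injective : ∀ {Q R : Subgroup P} {φ : Q →* R}, φ ∈ hom Q R → Function.Injective φ
  conj_mem : ∀ {Q R : Subgroup P} (φ : Q →* R) (g : P),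
    (∀ x : Q, (φ x : P) = g * x * g⁻¹) → φ ∈ hom Q R
  comp_mem : ∀ {Q R S : Subgroup P} {φ : Q →* R} {ψ : R →* S},
    φ ∈ hom Q R → ψ ∈ hom R S → ψ.comp φ ∈ hom Q S
  rangeRestrict_mem : ∀ {Q R : Subgroup P} {φ : Q →* R}, φ ∈ hom Q R →
    (R.subtype.comp φ).rangeRestrict ∈ hom Q (R.subtype.comp φ).range
  symm_mem : ∀ {Q R : Subgroup P} {φ : Q ≃* R},
    φ.toMonoidHom ∈ hom Q R → φ.symm.toMonoidHom ∈ hom R Q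

namespace FusionSystem

variable {P : Type*} [Group P]

/-- Changing the codomain of a morphism of a fusion system gives a morphism. -/
theorem mem_of_eq (F : FusionSystem P) {Q R R' : Subgroup P} {φ : Q →* R} (hφ : φ ∈ F.hom Q R)
    (ψ : Q →* R') (h : ∀ x : Q, (ψ x : P) = φ x) : ψ ∈ F.hom Q R' := by
  have hle : (R.subtype.comp φ).range ≤ R' := by
    rintro _ ⟨x, rfl⟩
    have := (ψ x).2
    rw [h x] at this
    exact this
  have h1 : Subgroup.inclusion hle ∈ F.hom _ _ := F.conj_mem _ 1 (by simp)
  have h2 := F.comp_mem (F.rangeRestrict_mem hφ) h1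
  convert h2 using 1
  ext x
  exact h x

/-- Two subgroups are `F`-conjugate if they are isomorphic in the category `F`. -/
def IsConj (F : FusionSystem P) (Q R : Subgroup P) : Prop :=
  ∃ φ : Q ≃* R, φ.toMonoidHom ∈ F.hom Q R

/-- `Q` is fully `F`-normalized: `|N_P(R)| ≤ |N_P(Q)|` for all `R` that are `F`-conjugate to `Q`. -/
def IsFullyNormalized (F : FusionSystem P) (Q : Subgroup P) : Prop :=
  ∀ R : Subgroup P, F.IsConj Q R →
    Nat.card (Subgroup.normalizer (R : Set P)) ≤ Nat.card (Subgroup.normalizer (Q : Set P))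

/-- `Q` is fully `F`-centralized: `|C_P(R)| ≤ |C_P(Q)|` for all `R` that are `F`-conjugate to
`Q`. -/
def IsFullyCentralized (F : FusionSystem P) (Q : Subgroup P) : Prop :=
  ∀ R : Subgroup P, F.IsConj Q R →
    Nat.card (Subgroup.centralizer (R : Set P)) ≤ Nat.card (Subgroup.centralizer (Q : Set P))

/-- `Aut_F(Q)`, as a subgroup of the automorphism group of `Q`. -/
def autGroup (F : FusionSystem P) (Q : Subgroup P) : Subgroup (MulAut Q) where
  carrier := {α | MulEquiv.toMonoidHom α ∈ F.hom Q Q}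
  mul_mem' := fun {_ _} ha hb => F.comp_mem hb ha
  one_mem' := F.conj_mem _ 1 (fun x => by simp)
  inv_mem' := fun {_} ha => F.symm_mem ha

/-- `Aut_P(Q) ≅ N_P(Q) / C_P(Q)`: the automorphisms of `Q` induced by conjugation by elements of
`N_P(Q)`. -/
def conjAutGroup (Q : Subgroup P) : Subgroup (MulAut Q) :=
  Q.normalizerMonoidHom.range

/-- The subgroup `N_φ` attached to `φ : Q → P`: all `g ∈ N_P(Q)` such that conjugation by `g`
on `Q` is carried by `φ` to conjugation by some element of `N_P(φ(Q))` on `φ(Q)`. -/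
def extender {Q : Subgroup P} (φ : Q →* (⊤ : Subgroup P)) : Subgroup P where
  carrier := {g | g ∈ Subgroup.normalizer (Q : Set P) ∧
    ∃ h ∈ Subgroup.normalizer (((⊤ : Subgroup P).subtype.comp φ).range : Set P),
      ∀ u v : Q, (v : P) = g * u * g⁻¹ → (φ v : P) = h * φ u * h⁻¹}
  mul_mem' := by
    rintro a b ⟨ha, h, hh, H⟩ ⟨hb, k, hk, K⟩
    refine ⟨mul_mem ha hb, h * k, mul_mem hh hk, fun u v huv => ?_⟩
    have hw : b * u * b⁻¹ ∈ Q := (Subgroup.mem_normalizer_iff.1 hb u).1 u.2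
    rw [H ⟨_, hw⟩ v (by simp [huv, mul_assoc]), K u ⟨_, hw⟩ rfl]
    group
  one_mem' := ⟨one_mem _, 1, one_mem _, fun u v huv => by
    have : v = u := by ext; simpa using huv
    simp [this]⟩
  inv_mem' := by
    rintro a ⟨ha, h, hh, H⟩
    refine ⟨inv_mem ha, h⁻¹, inv_mem hh, fun u v huv => ?_⟩
    rw [H v u (by rw [huv]; group)]
    group

theorem le_extender {Q : Subgroup P} (φ : Q →* (⊤ : Subgroup P)) : Q ≤ extender φ := by
  intro g hg
  refine ⟨Subgroup.le_normalizer hg, φ ⟨g, hg⟩, Subgroup.le_normalizer ⟨⟨g, hg⟩, rfl⟩,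
    fun u v huv => ?_⟩
  have : v = ⟨g, hg⟩ * u * ⟨g, hg⟩⁻¹ := by ext; simpa using huv
  simp [this]

/-- A fusion system on a finite `p`-group `P` is saturated if
* (Sylow axiom) every fully normalized subgroup `Q` is fully centralized, and `Aut_P(Q)` is a
  Sylow `p`-subgroup of `Aut_F(Q)`;
* (extension axiom) every morphism `φ : Q → P` in `F` with fully centralized image extends to a
  morphism `N_φ → P` in `F`. -/
structure IsSaturated (p : ℕ) (F : FusionSystem P) : Prop where
  fullyCentralized : ∀ Q : Subgroup P, F.IsFullyNormalized Q → F.IsFullyCentralized Q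
  sylow : ∀ Q : Subgroup P, F.IsFullyNormalized Q →
    ∃ S : Sylow p (F.autGroup Q), (S : Subgroup (F.autGroup Q)) =
      (conjAutGroup Q).subgroupOf (F.autGroup Q)
  extension : ∀ (Q : Subgroup P), ∀ φ ∈ F.hom Q ⊤,
    F.IsFullyCentralized ((⊤ : Subgroup P).subtype.comp φ).range →
      ∃ ψ ∈ F.hom (extender φ) ⊤, ψ.comp (Subgroup.inclusion (le_extender φ)) = φ

/-- For `Q` normal in `P` (so that `N_P(Q) = P`), the fusion system `N_F(Q)` on `P`: its
morphisms `R → S` are the morphisms `φ : R → S` in `F` that extend to a morphism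
`ψ : QR → QS` in `F` with `ψ(Q) = Q`. -/
def normalizer (F : FusionSystem P) (Q : Subgroup P) [hQ : Q.Normal] : FusionSystem P where
  hom R S := {φ | φ ∈ F.hom R S ∧ ∃ ψ ∈ F.hom (Q ⊔ R) (Q ⊔ S),
    (∀ (x : P) (hx : x ∈ R), (ψ ⟨x, le_sup_right (a := Q) hx⟩ : P) = φ ⟨x, hx⟩) ∧
    (Q.subgroupOf (Q ⊔ R)).map ψ = Q.subgroupOf (Q ⊔ S)}
  injective h := F.injective h.1
  conj_mem {R S} φ g h := by
    refine ⟨F.conj_mem φ g h, ?_⟩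
    have hle : ∀ x ∈ Q ⊔ R, g * x * g⁻¹ ∈ Q ⊔ S := by
      have : Q ⊔ R ≤ (Q ⊔ S).comap (MulAut.conj g).toMonoidHom := by
        refine sup_le (fun x hx => ?_) (fun x hx => ?_)
        · exact le_sup_left (a := Q) (hQ.conj_mem x hx g)
        · have := (φ ⟨x, hx⟩).2
          rw [h] at this
          exact le_sup_right (a := Q) this
      exact fun x hx => this hx
    let ψ : (Q ⊔ R : Subgroup P) →* (Q ⊔ S : Subgroup P) :=
      { toFun := fun x => ⟨g * x * g⁻¹, hle x x.2⟩
        map_one' := by ext; simp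
        map_mul' := fun x y => by ext; simp }
    refine ⟨ψ, F.conj_mem ψ g (fun x => rfl), fun x hx => (h ⟨x, hx⟩).symm, ?_⟩
    ext y
    constructor
    · rintro ⟨x, hx, rfl⟩
      exact hQ.conj_mem _ hx g
    · intro hy
      have hy' : g⁻¹ * (y : P) * g ∈ Q := by simpa using hQ.conj_mem _ hy g⁻¹
      refine ⟨⟨g⁻¹ * (y : P) * g, le_sup_left (a := Q) hy'⟩, hy', ?_⟩
      ext
      change g * (g⁻¹ * (y : P) * g) * g⁻¹ = y
      group
  comp_mem := by
    rintro R S T φ φ' ⟨hφ, ψ, hψ, h1, h2⟩ ⟨hφ', ψ', hψ', h1', h2'⟩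
    refine ⟨F.comp_mem hφ hφ', ψ'.comp ψ, F.comp_mem hψ hψ', fun x hx => ?_, ?_⟩
    · have : ψ ⟨x, le_sup_right (a := Q) hx⟩ =
          ⟨φ ⟨x, hx⟩, le_sup_right (a := Q) (φ ⟨x, hx⟩).2⟩ := by ext; exact h1 x hx
      rw [MonoidHom.comp_apply, this]
      exact h1' _ (φ ⟨x, hx⟩).2
    · rw [← Subgroup.map_map, h2, h2']
  rangeRestrict_mem := by
    rintro R S φ ⟨hφ, ψ, hψ, h1, h2⟩
    refine ⟨F.rangeRestrict_mem hφ, ?_⟩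
    set T := (S.subtype.comp φ).range with hT
    have hle : ∀ x : (Q ⊔ R : Subgroup P), (ψ x : P) ∈ Q ⊔ T := by
      have : Q ⊔ R ≤ ((Q ⊔ T).comap ((Q ⊔ S).subtype.comp ψ)).map (Q ⊔ R).subtype := by
        refine sup_le (fun x hx => ?_) (fun x hx => ?_)
        · refine ⟨⟨x, le_sup_left (a := Q) hx⟩, ?_, rfl⟩
          have : ψ ⟨x, le_sup_left (a := Q) hx⟩ ∈ Q.subgroupOf (Q ⊔ S) :=
            h2 ▸ Subgroup.mem_map_of_mem ψ hx
          exact le_sup_left (a := Q) this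
        · refine ⟨⟨x, le_sup_right (a := Q) hx⟩, ?_, rfl⟩
          refine le_sup_right (a := Q) ?_
          exact ⟨⟨x, hx⟩, (h1 x hx).symm⟩
      intro x
      obtain ⟨y, hy, hyx⟩ := this x.2
      have : y = x := Subtype.ext hyx
      exact this ▸ hy
    let ψ' : (Q ⊔ R : Subgroup P) →* (Q ⊔ T : Subgroup P) :=
      ((Q ⊔ S).subtype.comp ψ).codRestrict (Q ⊔ T) hle
    refine ⟨ψ', F.mem_of_eq hψ ψ' (fun x => rfl), fun x hx => h1 x hx, ?_⟩
    ext y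
    constructor
    · rintro ⟨x, hx, rfl⟩
      have : ψ x ∈ Q.subgroupOf (Q ⊔ S) := h2 ▸ Subgroup.mem_map_of_mem ψ hx
      exact this
    · intro hy
      have : (⟨y, le_sup_left (a := Q) hy⟩ : (Q ⊔ S : Subgroup P)) ∈ Q.subgroupOf (Q ⊔ S) := hy
      rw [← h2] at this
      obtain ⟨x, hx, hxy⟩ := this
      have hval : (ψ x : P) = y := congrArg Subtype.val hxy
      exact ⟨x, hx, Subtype.ext hval⟩
  symm_mem := by
    rintro R S φ ⟨hφ, ψ, hψ, h1, h2⟩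
    have hsurj : Function.Surjective ψ := by
      have : Q ⊔ S ≤ ψ.range.map (Q ⊔ S).subtype := by
        refine sup_le (fun y hy => ?_) (fun y hy => ?_)
        · have : (⟨y, le_sup_left (a := Q) hy⟩ : (Q ⊔ S : Subgroup P)) ∈
            Q.subgroupOf (Q ⊔ S) := hy
          rw [← h2] at this
          obtain ⟨x, -, hxy⟩ := this
          exact ⟨_, ⟨x, rfl⟩, congrArg Subtype.val hxy⟩
        · refine ⟨_, ⟨⟨φ.symm ⟨y, hy⟩, le_sup_right (a := Q) (φ.symm ⟨y, hy⟩).2⟩, rfl⟩, ?_⟩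
          have := h1 _ (φ.symm ⟨y, hy⟩).2
          simpa using this
      intro y
      obtain ⟨_, ⟨x, rfl⟩, hx⟩ := this y.2
      exact ⟨x, Subtype.ext hx⟩
    let e : (Q ⊔ R : Subgroup P) ≃* (Q ⊔ S : Subgroup P) :=
      MulEquiv.ofBijective ψ ⟨F.injective hψ, hsurj⟩
    have he : ∀ x, e x = ψ x := fun _ => rfl
    refine ⟨F.symm_mem hφ, e.symm.toMonoidHom, F.symm_mem (φ := e) hψ, fun y hy => ?_, ?_⟩
    · have : e.symm ⟨y, le_sup_right (a := Q) hy⟩ =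
          ⟨φ.symm ⟨y, hy⟩, le_sup_right (a := Q) (φ.symm ⟨y, hy⟩).2⟩ := by
        rw [MulEquiv.symm_apply_eq, he]
        ext
        rw [h1 _ (φ.symm ⟨y, hy⟩).2]
        simp
      exact congrArg Subtype.val this
    · rw [← h2, Subgroup.map_map]
      convert Subgroup.map_id _
      ext x
      exact congrArg Subtype.val (e.symm_apply_apply x)

/-- The fusion system on `P` of a group `G` in which `P` is embedded by `ι`: its morphisms
`Q → R` are the maps induced by conjugation by elements of `G`. -/
def ofEmbedding {G : Type*} [Group G] (ι : P →* G) (hι : Function.Injective ι) :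
    FusionSystem P where
  hom Q R := {φ | ∃ g : G, ∀ x : Q, ι (φ x) = g * ι x * g⁻¹}
  injective := by
    rintro Q R φ ⟨g, hg⟩ x y hxy
    have := hg x
    rw [hxy, hg y] at this
    exact Subtype.ext (hι (by simpa using this.symm))
  conj_mem φ g h := ⟨ι g, fun x => by simp [h x]⟩
  comp_mem := by
    rintro Q R S φ ψ ⟨g, hg⟩ ⟨k, hk⟩
    exact ⟨k * g, fun x => by simp [hk, hg, mul_assoc]⟩
  rangeRestrict_mem := by
    rintro Q R φ ⟨g, hg⟩
    exact ⟨g, hg⟩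
  symm_mem := by
    rintro Q R φ ⟨g, hg⟩
    refine ⟨g⁻¹, fun y => ?_⟩
    have := hg (φ.symm y)
    simp only [MulEquiv.toMonoidHom_eq_coe, MonoidHom.coe_coe, MulEquiv.apply_symm_apply] at this
    rw [this]
    simp [mul_assoc]

end FusionSystem

/-- A group is metacyclic if it has a cyclic normal subgroup with cyclic quotient. -/
def IsMetacyclic (P : Type*) [Group P] : Prop :=
  ∃ (N : Subgroup P) (_ : N.Normal), IsCyclic N ∧ IsCyclic (P ⧸ N)

/-- A finite `p`-group `P` is resistant if every saturated fusion system on `P` is the fusion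
system of a semidirect product `P ⋊ A`, for some group `A` of automorphisms of `P` of order prime
to `p`. -/
def IsResistant (p : ℕ) (P : Type*) [Group P] : Prop :=
  ∀ F : FusionSystem P, F.IsSaturated p →
    ∃ A : Subgroup (MulAut P), ¬ p ∣ Nat.card A ∧
      F = FusionSystem.ofEmbedding (SemidirectProduct.inl : P →* P ⋊[A.subtype] A)
        SemidirectProduct.inl_injective

/-! By downward induction on the order of `Q`, every morphism starting at `Q` is the restriction of
an element of `Aut_F(P)` (`FusionSystem.IsSaturated.extendsFrom`). The Sylow and extension axioms
reduce this to the automorphisms in `Aut_F(S)`, where `S` is fully normalized and proper. There `g`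
extends as soon as it conjugates the action `c_x` of some `x ∉ S` into `Aut_P(S)`, because it then
extends to a larger subgroup.

Suppose some `g` does not extend (`IsMetacyclic.forall_extends`). Let `Aut_F(S)` act on `Hom(S,
ℤ/p)`, the dual of the Frattini quotient, which has dimension at most 2 since `S` is metacyclic. The
kernel of this action is a `p`-group (`IsPGroup.ker_dualAction`), and the choice of `g` forces it
into `Inn(S)`. So `c_x` and its conjugate by `g` act as two unipotents, the second not a power of
the first, and they generate a group containing `-1` (`neg_one_mem_of_unipotent`). Lift `-1` to an
involution `σ`. As `-1` is central, `σ` normalizes `c_x` modulo `Inn(S)`, so `σ` does extend to `P`,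
and since `|P|` is odd the extension can be chosen to fix an element of `xS`
(`exists_fixed_mul_of_involution`).

Such an involution cannot exist (`IsPGroup.false_of_involution_fixing`): it makes `S` abelian and
inverted by `σ`, so a fixed `x` with `x ^ p ∈ S` has order `p`, and the cyclic normal subgroup of
`P` leaves no room for the non-trivial action of `x`.

Given the extension property, a Schur–Zassenhaus complement of `Inn(P)` in `Aut_F(P)` provides the
group `A`. -/

/-! ### Unipotent endomorphisms of a plane over `𝔽_p`. -/

section LinearAlgebra

variable {p : ℕ} [Fact p.Prime] {V : Type*} [AddCommGroup V] [Module (ZMod p) V]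

theorem Module.End.neg_one_pow_of_odd {n : ℕ} (hn : Odd n) :
    (-1 : Module.End (ZMod p) V) ^ n = -1 := hn.neg_one_pow

theorem Module.End.neg_one_mul_neg_one : (-1 : Module.End (ZMod p) V) * -1 = 1 := by
  rw [neg_mul_neg, one_mul]

theorem Module.End.neg_one_mul_eq_mul_neg_one (e : Module.End (ZMod p) V) : -1 * e = e * -1 :=
  (Commute.neg_one_left e).eq

variable [Module.Finite (ZMod p) V]

/-- In characteristic `p`, `(τ - 1) ^ p ^ k = τ ^ p ^ k - 1 = 0`, and the kernels of the powers of
an endomorphism are stable from the dimension on. -/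
theorem Module.End.sub_one_sq_eq_zero_of_pow_prime_pow_eq_one
    (hV : Module.finrank (ZMod p) V ≤ 2) {τ : Module.End (ZMod p) V} {k : ℕ}
    (h : τ ^ p ^ k = 1) : (τ - 1) ^ 2 = 0 := by
  rcases subsingleton_or_nontrivial V with hs | hs
  · ext v
    exact Subsingleton.elim _ _
  have : CharP (Module.End (ZMod p) V) p :=
    charP_of_injective_algebraMap (FaithfulSMul.algebraMap_injective (ZMod p) _) p
  have h0 : (τ - 1) ^ p ^ k = 0 := by
    rw [sub_pow_char_pow_of_commute p k (Commute.one_right τ), h, one_pow, sub_self]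
  have h1 : (τ - 1) ^ (p ^ k + 2) = 0 := by rw [pow_add, h0, zero_mul]
  rw [← LinearMap.ker_eq_top, Module.End.ker_pow_eq_ker_pow_finrank_of_le hV,
    ← Module.End.ker_pow_eq_ker_pow_finrank_of_le (m := p ^ k + 2) (by omega),
    LinearMap.ker_eq_top, h1]

/-- Vectors `b`, `D b` form a basis if `D` is a square zero endomorphism of a space of dimension at
most two and `D b ≠ 0`. -/
theorem exists_eq_smul_add_smul_of_sq_eq_zero (hV : Module.finrank (ZMod p) V ≤ 2)
    {D : Module.End (ZMod p) V} (hD : ∀ v, D (D v) = 0) {b : V} (hb : D b ≠ 0) (v : V) :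
    ∃ c d : ZMod p, v = c • D b + d • b := by
  have hli : LinearIndependent (ZMod p) ![D b, b] := by
    rw [LinearIndependent.pair_iff]
    intro s t h
    have h2 := congrArg D h
    rw [map_add, map_smul, map_smul, hD, smul_zero, zero_add, map_zero] at h2
    have ht : t = 0 := (smul_eq_zero.1 h2).resolve_right hb
    rw [ht, zero_smul, add_zero] at h
    exact ⟨(smul_eq_zero.1 h).resolve_right hb, ht⟩
  have hcard : Fintype.card (Fin 2) = Module.finrank (ZMod p) V := by
    have := hli.fintype_card_le_finrank
    simp only [Fintype.card_fin] at this ⊢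
    omega
  have hv : v ∈ Submodule.span (ZMod p) (Set.range ![D b, b]) := by
    rw [hli.span_eq_top_of_card_eq_finrank' hcard]
    trivial
  rw [Matrix.range_cons, Matrix.range_cons, Matrix.range_empty, Set.union_empty,
    Set.singleton_union, Submodule.mem_span_pair] at hv
  obtain ⟨c, d, h⟩ := hv
  exact ⟨c, d, h.symm⟩

/-- Two unipotent endomorphisms of a plane over `𝔽_p`, the second of which is not a power of the
first, generate a group containing `-1`. -/
theorem neg_one_mem_of_unipotent (hV : Module.finrank (ZMod p) V ≤ 2)
    (Γ : Submonoid (Module.End (ZMod p) V)) {τ τ' : Module.End (ZMod p) V}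
    (hτ : τ ∈ Γ) (hτ' : τ' ∈ Γ) {k k' : ℕ} (hk : τ ^ p ^ k = 1) (hk' : τ' ^ p ^ k' = 1)
    (h1 : τ ≠ 1) (hpow : ∀ n : ℕ, τ' ≠ τ ^ n) : -1 ∈ Γ := by
  have key : ∀ {υ : Module.End (ZMod p) V} {k : ℕ}, υ ^ p ^ k = 1 →
      ∀ v, (υ - 1) ((υ - 1) v) = 0 := fun h v => by
    have := LinearMap.congr_fun
      (Module.End.sub_one_sq_eq_zero_of_pow_prime_pow_eq_one hV h) v
    simpa only [sq, Module.End.mul_apply, LinearMap.zero_apply] using this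
  have hpowapply : ∀ {υ : Module.End (ZMod p) V}, (∀ v, (υ - 1) ((υ - 1) v) = 0) →
      ∀ (n : ℕ) v, (υ ^ n) v = v + (n : ZMod p) • (υ - 1) v := by
    intro υ hυ n v
    induction n with
    | zero => simp
    | succ n ih =>
      have h3 := hυ v
      rw [pow_succ', Module.End.mul_apply, ih]
      simp only [LinearMap.sub_apply, Module.End.one_apply, map_sub, map_add, map_smul] at h3 ⊢
      have : υ (υ v) = υ v + (υ v - v) := by
        rw [← sub_eq_zero, ← h3]; abel
      rw [this]
      push_cast
      module
  have hD := key hk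
  have hD' := key hk'
  have hp := hpowapply hD
  have hp' := hpowapply hD'
  set D := τ - 1 with hDdef
  set D' := τ' - 1 with hDdef'
  have eτ : ∀ v, τ v = v + D v := fun v => by simp [hDdef]
  have eτ' : ∀ v, τ' v = v + D' v := fun v => by simp [hDdef']
  obtain ⟨b, hb⟩ : ∃ b, D b ≠ 0 := by
    by_contra! h
    exact h1 (sub_eq_zero.1 (LinearMap.ext h))
  obtain ⟨b', hb'⟩ : ∃ b, D' b ≠ 0 := by
    by_contra! h
    exact hpow 0 (by rw [pow_zero]; exact sub_eq_zero.1 (LinearMap.ext h))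
  have hbas := exists_eq_smul_add_smul_of_sq_eq_zero hV hD hb
  obtain ⟨c, d, hcd⟩ := hbas (D' b')
  set a := D b with ha
  have hDa : D a = 0 := hD b
  -- If `d = 0`, then `D` and `D'` share the image line spanned by `a`, so `D'` is a multiple of `D`
  -- and `τ'` a power of `τ`.
  by_cases hd : d = 0
  · exfalso
    rw [hd, zero_smul, add_zero] at hcd
    have hc : c ≠ 0 := by
      rintro rfl
      exact hb' (by rw [hcd, zero_smul])
    have hD'a : D' a = 0 := by
      have := hD' b'
      rw [hcd, map_smul] at this
      exact (smul_eq_zero.1 this).resolve_left hc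
    obtain ⟨e, f, hef⟩ := hbas (D' b)
    have hf : f • D' b = 0 := by
      have := hD' b
      rwa [hef, map_add, map_smul, map_smul, hD'a, smul_zero, zero_add] at this
    have hDb : D' b = e • a := by
      rcases smul_eq_zero.1 hf with h | h
      · rw [hef, h, zero_smul, add_zero]
      · exfalso
        obtain ⟨s, t, hst⟩ := hbas b'
        apply hb'
        rw [hst, map_add, map_smul, map_smul, hD'a, h, smul_zero, smul_zero, add_zero]
    refine hpow e.val (LinearMap.ext fun v => ?_)
    obtain ⟨s, t, rfl⟩ := hbas v
    rw [hp, eτ', ZMod.natCast_zmod_val]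
    simp only [map_add, map_smul, hD'a, hDb, hDa, ← ha]
    module
  -- Otherwise the image lines differ. In the basis `a`, `b₁` the two unipotents are opposite: `D b₁
  -- = a`, `D a = 0`, `D' b₁ = 0`, `D' a = t • b₁`.
  · set b₁ := d⁻¹ • D' b' with hb₁
    have hb₁' : b₁ = (d⁻¹ * c) • a + b := by
      rw [hb₁, hcd, smul_add, smul_smul, smul_smul, inv_mul_cancel₀ hd, one_smul]
    have hDb₁ : D b₁ = a := by
      rw [hb₁', map_add, map_smul, hDa, smul_zero, zero_add]
    have hD'b₁ : D' b₁ = 0 := by rw [hb₁, map_smul, hD', smul_zero]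
    have hbas₁ := exists_eq_smul_add_smul_of_sq_eq_zero hV hD (b := b₁) (by rwa [hDb₁])
    rw [hDb₁] at hbas₁
    obtain ⟨s, t, hst⟩ := hbas₁ (D' a)
    have hD'a : D' a ≠ 0 := by
      intro h
      apply hb'
      obtain ⟨u, v, huv⟩ := hbas₁ b'
      rw [huv, map_add, map_smul, map_smul, h, hD'b₁, smul_zero, smul_zero, add_zero]
    have hs : s = 0 := by
      have := hD' a
      rw [hst, map_add, map_smul, map_smul, hD'b₁, smul_zero, add_zero] at this
      exact (smul_eq_zero.1 this).resolve_right hD'a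
    rw [hs, zero_smul, zero_add] at hst
    have ht : t ≠ 0 := by
      rintro rfl
      exact hD'a (by rw [hst, zero_smul])
    -- This product is the Weyl element of `SL₂`, sending `a` to `-b₁` and `b₁` to `a`. The exponent
    -- `-t⁻¹` normalizes the lower unipotent.
    have hw : (τ * τ' ^ (-t⁻¹).val * τ) ^ 2 = -1 := by
      have hwa : (τ * τ' ^ (-t⁻¹).val * τ) a = -b₁ := by
        simp only [Module.End.mul_apply, hp', eτ, ZMod.natCast_zmod_val, map_add, map_smul, hDa,
          hst, hDb₁, map_zero, smul_smul, neg_mul, inv_mul_cancel₀ ht]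
        module
      have hwb : (τ * τ' ^ (-t⁻¹).val * τ) b₁ = a := by
        simp only [Module.End.mul_apply, hp', eτ, ZMod.natCast_zmod_val, map_add, map_smul, hDa,
          hst, hDb₁, map_zero, smul_smul, neg_mul, inv_mul_cancel₀ ht, hD'b₁]
        module
      ext v
      obtain ⟨s, t, rfl⟩ := hbas₁ v
      rw [sq, Module.End.mul_apply, map_add, map_smul, map_smul, hwa, hwb, map_add, map_smul,
        map_smul, hwa, map_neg, hwb]
      simp only [LinearMap.neg_apply, Module.End.one_apply]
      module
    rw [← hw]
    exact pow_mem (mul_mem (mul_mem hτ (pow_mem hτ' _)) hτ) 2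

end LinearAlgebra

/-! ### The action of automorphisms on the dual of the Frattini quotient. -/

section Dual

variable {p : ℕ} [Fact p.Prime] {S : Type*} [Group S]

/-- A proper subgroup of a finite `p`-group is contained in the kernel of a non-zero homomorphism to
`ℤ/p`. -/
theorem IsPGroup.exists_addMonoidHom_zmod_ne_zero [Finite S] (hS : IsPGroup p S) {F : Subgroup S}
    (hF : F ≠ ⊤) : ∃ χ : Additive S →+ ZMod p, χ ≠ 0 ∧ ∀ f ∈ F, χ (Additive.ofMul f) = 0 := by
  obtain ⟨M, hM, hFM⟩ := (eq_top_or_exists_le_coatom F).resolve_left hF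
  have := hS.isNilpotent
  have hn : M.Normal := Subgroup.NormalizerCondition.normal_of_coatom M
    Group.normalizerCondition_of_isNilpotent hM
  have hq : IsPGroup p (S ⧸ M) := hS.to_quotient M
  have hnt : Nontrivial (S ⧸ M) := QuotientGroup.nontrivial_iff.2 hM.1
  have hdvd : p ∣ Nat.card (S ⧸ M) := by
    obtain ⟨n, hn0, hn⟩ := (hq.nontrivial_iff_card).1 hnt
    rw [hn]
    exact dvd_pow_self p hn0.ne'
  obtain ⟨y, hy⟩ := exists_prime_orderOf_dvd_card' p hdvd
  have hytop : Subgroup.zpowers y = ⊤ := by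
    have h1 : M < (Subgroup.zpowers y).comap (QuotientGroup.mk' M) := by
      obtain ⟨s, rfl⟩ := QuotientGroup.mk'_surjective M y
      refine SetLike.lt_iff_le_and_exists.2 ⟨fun m hm => ?_, s, Subgroup.mem_zpowers _, ?_⟩
      · have : QuotientGroup.mk' M m = 1 := (QuotientGroup.eq_one_iff m).2 hm
        rw [Subgroup.mem_comap, this]
        exact one_mem _
      · intro hs
        have : QuotientGroup.mk' M s = 1 := (QuotientGroup.eq_one_iff s).2 hs
        rw [this, orderOf_one] at hy
        exact (Fact.out : p.Prime).ne_one hy.symm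
    have h2 := hM.2 _ h1
    rw [← Subgroup.map_comap_eq_self_of_surjective (QuotientGroup.mk'_surjective M)
      (Subgroup.zpowers y), h2, Subgroup.map_top_of_surjective _ (QuotientGroup.mk'_surjective M)]
  have hcard : Nat.card (S ⧸ M) = p := by
    rw [← hy, ← Nat.card_zpowers, hytop, Subgroup.card_top]
  let e : S ⧸ M ≃* Multiplicative (ZMod p) :=
    mulEquivOfPrimeCardEq hcard (by simp)
  let f : S →* Multiplicative (ZMod p) := e.toMonoidHom.comp (QuotientGroup.mk' M)
  have hf : ∀ s, f s = 1 ↔ s ∈ M := fun s => by simp [f]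
  refine ⟨MonoidHom.toAdditiveLeft f, fun h => hM.1 (eq_top_iff.2 fun s _ => (hf s).1 ?_),
    fun s hs => ?_⟩
  · exact DFunLike.congr_fun h (Additive.ofMul s)
  · exact (hf s).2 (hFM hs)

/-- The action of the automorphisms of a group on its homomorphisms to `ℤ/p`. -/
def dualAction (p : ℕ) [Fact p.Prime] (S : Type*) [Group S] :
    MulAut S →* Module.End (ZMod p) (Additive S →+ ZMod p) where
  toFun g :=
    { toFun := fun χ => χ.comp (MonoidHom.toAdditive (g⁻¹ : MulAut S).toMonoidHom)
      map_add' := fun χ ψ => rfl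
      map_smul' := fun c χ => rfl }
  map_one' := rfl
  map_mul' g h := by
    ext χ s
    rfl

theorem dualAction_apply (g : MulAut S) (χ : Additive S →+ ZMod p) (s : S) :
    dualAction p S g χ (Additive.ofMul s) = χ (Additive.ofMul (g⁻¹ s)) := rfl

theorem dualAction_eq_one_iff {g : MulAut S} : dualAction p S g = 1 ↔
    ∀ (χ : Additive S →+ ZMod p) s, χ (Additive.ofMul (g s)) = χ (Additive.ofMul s) := by
  constructor
  · intro h χ s
    have := DFunLike.congr_fun (LinearMap.congr_fun h χ) (Additive.ofMul (g s))
    rw [dualAction_apply] at this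
    simpa using this.symm
  · intro h
    ext χ s
    have := h χ (g⁻¹ s)
    simpa [dualAction_apply] using this.symm

theorem dualAction_eq_neg_one {g : MulAut S} (h : dualAction p S g = -1)
    (χ : Additive S →+ ZMod p) (s : S) : χ (Additive.ofMul (g s)) = -χ (Additive.ofMul s) := by
  have h2 : χ (Additive.ofMul (g⁻¹ (g s))) = -χ (Additive.ofMul (g s)) :=
    DFunLike.congr_fun (LinearMap.congr_fun h χ) (Additive.ofMul (g s))
  rw [MulAut.inv_apply_self] at h2
  rw [h2, neg_neg]

theorem finrank_dual_le_two [Finite S] {a b : S} (h : Subgroup.closure {a, b} = ⊤) :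
    Module.finrank (ZMod p) (Additive S →+ ZMod p) ≤ 2 := by
  let f : (Additive S →+ ZMod p) →ₗ[ZMod p] (Fin 2 → ZMod p) :=
    { toFun := fun χ => ![χ (Additive.ofMul a), χ (Additive.ofMul b)]
      map_add' := fun χ ψ => by ext i; fin_cases i <;> rfl
      map_smul' := fun c χ => by ext i; fin_cases i <;> rfl }
  have hf : Function.Injective f := by
    intro χ ψ hχ
    have h0 : χ (Additive.ofMul a) = ψ (Additive.ofMul a) := congrFun hχ 0
    have h1 : χ (Additive.ofMul b) = ψ (Additive.ofMul b) := congrFun hχ 1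
    refine AddMonoidHom.toMultiplicativeRight.injective
      (MonoidHom.eq_of_eqOn_dense h ?_)
    rintro x (rfl | rfl)
    · exact h0
    · exact h1
  simpa using LinearMap.finrank_le_finrank_of_injective hf

/-- The kernel of the action of automorphisms on the Frattini quotient contains no elements of prime
order other than `p`. -/
theorem IsPGroup.eq_one_of_dualAction_eq_one [Finite S] (hS : IsPGroup p S) {r : ℕ}
    (hr : r.Prime) (hrp : r ≠ p) {g : MulAut S} (hg : g ^ r = 1)
    (h : dualAction p S g = 1) : g = 1 := by
  classical
  have := Fact.mk hr
  let F : Subgroup S := (g : MulAut S).toMonoidHom.eqLocus (MonoidHom.id S)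
  suffices hF : F = ⊤ by
    ext s
    have : s ∈ F := hF ▸ Subgroup.mem_top s
    exact this
  by_contra hF
  obtain ⟨χ, hχ, hχF⟩ := hS.exists_addMonoidHom_zmod_ne_zero hF
  obtain ⟨s, hs⟩ : ∃ s : S, χ (Additive.ofMul s) ≠ 0 := by
    by_contra! hall
    exact hχ (by ext s; exact hall s)
  -- The automorphism `g` permutes this fibre of `χ`, of `p`-power size like the kernel. A fixed
  -- point would lie in `F`, where `χ` vanishes, whereas `χ s ≠ 0`. Without fixed points, `r`
  -- divides a power of `p`.
  let X := {x : S // χ (Additive.ofMul x) = χ (Additive.ofMul s)}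
  have := Fintype.ofFinite X
  let f : Function.End X := fun x =>
    ⟨g x, (dualAction_eq_one_iff.1 h χ x).trans x.2⟩
  have hfpow : ∀ (n : ℕ) (x : X), ((f ^ n) x : S) = (g ^ n) x := by
    intro n x
    induction n with
    | zero => rfl
    | succ n ih =>
      rw [pow_succ', pow_succ', MulAut.mul_apply, ← ih]
      rfl
  have hf : f ^ r ^ 1 = 1 := by
    funext x
    ext
    rw [hfpow, pow_one, hg]
    rfl
  have hmod := Equiv.Perm.card_fixedPoints_modEq hf
  have hker : IsPGroup p (AddMonoidHom.toMultiplicativeRight χ).ker := hS.to_subgroup _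
  have hX : Fintype.card X = Nat.card (AddMonoidHom.toMultiplicativeRight χ).ker := by
    rw [← Nat.card_eq_fintype_card]
    exact Nat.card_congr ((AddMonoidHom.toMultiplicativeRight χ).fiberEquivKer s)
  obtain ⟨n, hn⟩ := hker.exists_card_eq
  have hempty : IsEmpty (Function.fixedPoints f) := by
    refine ⟨fun ⟨x, hx⟩ => hs ?_⟩
    have h1 : (x : S) ∈ F := congrArg Subtype.val hx
    rw [← x.2]
    exact hχF _ h1
  rw [Fintype.card_eq_zero (α := Function.fixedPoints f), hX, hn, Nat.modEq_zero_iff_dvd] at hmod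
  exact hrp ((Nat.prime_dvd_prime_iff_eq hr Fact.out).1 (hr.dvd_of_dvd_pow hmod))

/-- If a prime `r ≠ p` divided the order of `g` in the kernel, then `g ^ (orderOf g / r)` would be
trivial by the prime-order case, contradicting the order. -/
theorem IsPGroup.ker_dualAction [Finite S] (hS : IsPGroup p S) :
    IsPGroup p (dualAction p S).ker := by
  have : Finite (MulAut S) := inferInstance
  rintro ⟨g, hg⟩
  have hg0 : orderOf g ≠ 0 := (orderOf_pos g).ne'
  refine ⟨(orderOf g).primeFactorsList.length, ?_⟩
  suffices h : orderOf g = p ^ (orderOf g).primeFactorsList.length by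
    ext1
    simp only [SubmonoidClass.coe_pow, ← h, pow_orderOf_eq_one, OneMemClass.coe_one]
  refine Nat.eq_prime_pow_of_unique_prime_dvd hg0 fun {r} hr hrd => ?_
  by_contra hrp
  have h1 : g ^ (orderOf g / r) = 1 := by
    refine hS.eq_one_of_dualAction_eq_one hr hrp ?_ ?_
    · rw [← pow_mul, Nat.div_mul_cancel hrd, pow_orderOf_eq_one]
    · rw [map_pow, hg, one_pow]
  have h2 := Nat.le_of_dvd (Nat.div_pos (Nat.le_of_dvd (orderOf_pos g) hrd) hr.pos)
    (orderOf_dvd_of_pow_eq_one h1)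
  exact absurd h2 (not_le.2 (Nat.div_lt_self (orderOf_pos g) hr.one_lt))

end Dual

/-! ### Involutions inverting the Frattini quotient. -/

section PGroup

variable {p : ℕ} [Fact p.Prime] {S : Type*} [Group S]

theorem IsPGroup.mem_zpowers_zpow (hS : IsPGroup p S) (m : S) {j : ℤ} (hj : ¬ (p : ℤ) ∣ j) :
    m ∈ Subgroup.zpowers (m ^ j) := by
  obtain ⟨k, hk⟩ := hS m
  have hco : IsCoprime j ((p : ℤ) ^ k) :=
    (((Nat.prime_iff_prime_int.1 Fact.out).coprime_iff_not_dvd.2 hj).symm).pow_right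
  obtain ⟨u, v, huv⟩ := hco
  refine ⟨u, ?_⟩
  have hk' : m ^ ((p : ℤ) ^ k) = 1 := by exact_mod_cast hk
  calc (m ^ j) ^ u = m ^ (u * j + v * (p : ℤ) ^ k) := by
        rw [zpow_add, mul_comm v, zpow_mul _ _ v, hk', one_zpow, mul_one, mul_comm, zpow_mul]
    _ = m := by rw [huv, zpow_one]

theorem IsPGroup.eq_one_of_zpow_eq_one (hS : IsPGroup p S) {m : S} {j : ℤ} (hj : ¬ (p : ℤ) ∣ j)
    (h : m ^ j = 1) : m = 1 := by
  have := hS.mem_zpowers_zpow m hj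
  rwa [h, Subgroup.zpowers_one_eq_bot, Subgroup.mem_bot] at this

theorem not_prime_dvd_two (hp : p ≠ 2) : ¬ (p : ℤ) ∣ 2 := by
  intro h
  exact hp ((Nat.prime_dvd_prime_iff_eq Fact.out Nat.prime_two).1 (by exact_mod_cast h))

theorem ZMod.two_ne_zero_of_prime_ne_two (hp : p ≠ 2) : (2 : ZMod p) ≠ 0 := by
  intro h
  apply not_prime_dvd_two hp
  rw [← ZMod.intCast_zmod_eq_zero_iff_dvd 2 p]
  exact_mod_cast h

/-- Writing `a = m ^ j` with `m` a generator of `C`, `χ a = j χ m ≠ 0` makes `j` prime to `p`. -/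
theorem IsPGroup.eq_zpowers_of_dual_ne_zero (hS : IsPGroup p S) {C : Subgroup S} [IsCyclic C]
    {a : S} (ha : a ∈ C) {χ : Additive S →+ ZMod p} (hχ : χ (.ofMul a) ≠ 0) :
    C = Subgroup.zpowers a := by
  obtain ⟨m, rfl⟩ := C.isCyclic_iff_exists_zpowers_eq_top.1 inferInstance
  obtain ⟨j, rfl⟩ := ha
  refine le_antisymm (Subgroup.zpowers_le.2 (hS.mem_zpowers_zpow m fun h => hχ ?_))
    (Subgroup.zpowers_le.2 ⟨j, rfl⟩)
  change χ (.ofMul (m ^ j)) = 0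
  rw [ofMul_zpow, map_zsmul, zsmul_eq_mul, (ZMod.intCast_zmod_eq_zero_iff_dvd j p).2 h, zero_mul]

/-- If an automorphism inverts the Frattini quotient of a finite `p`-group of odd order, then the
elements `q⁻¹ * σ q` generate the group. -/
theorem IsPGroup.eq_top_of_inv_mul_mem [Finite S] (hS : IsPGroup p S) (hp : p ≠ 2) {σ : MulAut S}
    (hσ : dualAction p S σ = -1) {F : Subgroup S} (hF : ∀ q, q⁻¹ * σ q ∈ F) : F = ⊤ := by
  by_contra h
  obtain ⟨χ, hχ, hχF⟩ := hS.exists_addMonoidHom_zmod_ne_zero h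
  refine hχ (by
    ext q
    change χ (.ofMul q) = 0
    have h1 := hχF _ (hF q)
    rw [ofMul_mul, ofMul_inv, map_add, map_neg, dualAction_eq_neg_one hσ] at h1
    have h2 : 2 * χ (.ofMul q) = 0 := by linear_combination -h1
    exact (mul_eq_zero.1 h2).resolve_left (ZMod.two_ne_zero_of_prime_ne_two hp))

/-- An involution inverting the Frattini quotient of a metacyclic `p`-group, `p` odd, is the
inversion of an abelian group, under a mild condition on the cyclic normal subgroup. -/
theorem IsPGroup.commute_and_inv_of_dualAction_eq_neg_one [Finite S] (hS : IsPGroup p S)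
    (hp : p ≠ 2) {Q : Type*} [Group Q] [IsCyclic Q] (f : S →* Q) [IsCyclic f.ker] {σ : MulAut S}
    (hσ2 : σ * σ = 1) (hσ : dualAction p S σ = -1) {a : S} (ha : f a = 1) (hσa : f (σ a) = 1)
    {χ : Additive S →+ ZMod p} (hχ : χ (.ofMul a) ≠ 0) :
    (∀ s t : S, s * t = t * s) ∧ ∀ s, σ s = s⁻¹ := by
  have hσσ : ∀ s, σ (σ s) = s := fun s => DFunLike.congr_fun hσ2 s
  have hC : f.ker = Subgroup.zpowers a := hS.eq_zpowers_of_dual_ne_zero ha hχ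
  -- With `σ a = a ^ j`, the dual action gives `j ≡ -1` mod `p` and `σ² = 1` gives `a ^ ((j + 1) *
  -- (j - 1)) = 1`. As `p` is odd, `j - 1` is prime to `p`, so `a ^ (j + 1) = 1`.
  have hainv : σ a = a⁻¹ := by
    obtain ⟨j, hj⟩ : σ a ∈ Subgroup.zpowers a := hC ▸ hσa
    change a ^ j = σ a at hj
    have h1 : ((j + 1 : ℤ) : ZMod p) = 0 := by
      have h2 := dualAction_eq_neg_one hσ χ a
      rw [← hj, ofMul_zpow, map_zsmul, zsmul_eq_mul] at h2
      push_cast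
      refine (mul_eq_zero.1 (?_ : ((j : ZMod p) + 1) * χ (.ofMul a) = 0)).resolve_right hχ
      linear_combination h2
    rw [ZMod.intCast_zmod_eq_zero_iff_dvd] at h1
    have h3 : ¬ (p : ℤ) ∣ j - 1 := fun h => not_prime_dvd_two hp (by
      have := dvd_sub h1 h
      ring_nf at this
      exact this)
    have h4 : a ^ (j + 1) = 1 := by
      refine hS.eq_one_of_zpow_eq_one h3 ?_
      have h5 : a ^ (j * j) = a := by
        rw [zpow_mul, hj, ← map_zpow, hj, hσσ]
      rw [← zpow_mul, show (j + 1) * (j - 1) = j * j - 1 by ring, zpow_sub, h5, zpow_one,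
        mul_inv_cancel]
    rw [← hj, ← mul_eq_one_iff_eq_inv, ← h4, zpow_add, zpow_one]
  have hcent : ∀ q, q * a = a * q := by
    -- Applying `σ` to `q a q⁻¹ = a ^ k` and inverting shows that `q` and `σ q` conjugate `a` alike,
    -- so every `q⁻¹ * σ q` centralizes `a`.
    have h1 : Subgroup.centralizer {a} = ⊤ := by
      refine hS.eq_top_of_inv_mul_mem hp hσ fun q => ?_
      obtain ⟨k, hk⟩ : q * a * q⁻¹ ∈ Subgroup.zpowers a := by
        rw [← hC, MonoidHom.mem_ker, map_mul, map_mul, ha, mul_one, map_inv, mul_inv_cancel]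
      change a ^ k = _ at hk
      have h2 : σ q * a * (σ q)⁻¹ = a ^ k := by
        have h3 := congrArg σ hk
        rw [map_zpow, map_mul, map_mul, hainv, map_inv, inv_zpow] at h3
        rw [← inv_inj, h3]
        group
      rw [hk] at h2
      rw [Subgroup.mem_centralizer_singleton_iff]
      have h3 : σ q * a = q * a * q⁻¹ * σ q := by rw [← h2]; group
      rw [mul_assoc, h3]
      group
    intro q
    have : q ∈ Subgroup.centralizer {a} := h1 ▸ Subgroup.mem_top q
    exact (Subgroup.mem_centralizer_singleton_iff).1 this
  have hcomm : ∀ s t : S, s * t = t * s := by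
    have := MonoidHom.isMulCommutative_of_isCyclic_of_ker_le_center f (by
      rw [hC, Subgroup.zpowers_le, Subgroup.mem_center_iff]
      exact hcent)
    exact this.is_comm.comm
  refine ⟨hcomm, ?_⟩
  -- The inverted elements form a subgroup because `S` is abelian. It contains every `q⁻¹ * σ q`
  -- because `σ² = 1`.
  let F : Subgroup S :=
    { carrier := {q | σ q = q⁻¹}
      mul_mem' := fun {s t} hs ht => by
        change σ (s * t) = (s * t)⁻¹
        rw [map_mul, hs, ht, mul_inv_rev, hcomm]
      one_mem' := by simp
      inv_mem' := fun {s} hs => by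
        change σ s⁻¹ = s⁻¹⁻¹
        rw [map_inv, hs] }
  have hF : F = ⊤ := hS.eq_top_of_inv_mul_mem hp hσ fun q => by
    change σ (q⁻¹ * σ q) = (q⁻¹ * σ q)⁻¹
    rw [map_mul, hσσ, map_inv, mul_inv_rev, inv_inv]
  intro s
  exact (hF ▸ Subgroup.mem_top s : s ∈ F)

theorem exists_closure_pair_eq_top {Q : Type*} [Group Q] [IsCyclic Q] (f : S →* Q)
    [IsCyclic f.ker] : ∃ a b : S, Subgroup.closure {a, b} = ⊤ := by
  obtain ⟨a, ha⟩ := f.ker.isCyclic_iff_exists_zpowers_eq_top.1 inferInstance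
  obtain ⟨⟨_, b, rfl⟩, hb⟩ := IsCyclic.exists_generator (α := f.range)
  refine ⟨a, b, eq_top_iff.2 fun s _ => ?_⟩
  obtain ⟨n, hn⟩ := hb ⟨f s, s, rfl⟩
  have hn' : f b ^ n = f s := congrArg Subtype.val hn
  have h1 : s * (b ^ n)⁻¹ ∈ Subgroup.zpowers a := by
    rw [ha, MonoidHom.mem_ker, map_mul, map_inv, map_zpow, hn', mul_inv_cancel]
  have h2 : Subgroup.zpowers a ≤ Subgroup.closure {a, b} :=
    Subgroup.zpowers_le.2 (Subgroup.subset_closure (by simp))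
  have h3 : b ∈ Subgroup.closure {a, b} := Subgroup.subset_closure (by simp)
  simpa using mul_mem (h2 h1) (zpow_mem h3 n)

end PGroup

/-! ### Excluding an involution that fixes a normalizing element. -/

section Normalizer

variable {p : ℕ} [Fact p.Prime] {P : Type*} [Group P]

theorem pow_mul_of_commutator_commute {s y z : P} (h : y * s = z * (s * y)) (hy : Commute z y)
    (n : ℕ) : y ^ n * s = z ^ n * (s * y ^ n) := by
  induction n with
  | zero => simp
  | succ n ih =>
    calc y ^ (n + 1) * s = y ^ n * (y * s) := by rw [pow_succ, mul_assoc]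
      _ = z * (y ^ n * s) * y := by
        rw [h, ← mul_assoc, ← (hy.pow_right n).eq]
        simp only [mul_assoc]
      _ = z ^ (n + 1) * (s * y ^ (n + 1)) := by
        rw [ih, pow_succ' z, pow_succ y]
        simp only [mul_assoc]

/-- Class-two collection: moving the last `s` left past `y ^ n` costs `z ^ n`, and these exponents
add up to the binomial coefficient. -/
theorem mul_pow_of_commutator_commute {s y z : P} (h : y * s = z * (s * y)) (hs : Commute z s)
    (hy : Commute z y) (n : ℕ) : (s * y) ^ n = z ^ (n * (n - 1) / 2) * (s ^ n * y ^ n) := by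
  induction n with
  | zero => simp
  | succ n ih =>
    have h2 : (n + 1) * (n + 1 - 1) / 2 = n * (n - 1) / 2 + n := by
      rw [← Finset.sum_range_id_mul_two, ← Finset.sum_range_id_mul_two,
        Nat.mul_div_cancel _ two_pos, Nat.mul_div_cancel _ two_pos, Finset.sum_range_succ]
    calc (s * y) ^ (n + 1) = z ^ (n * (n - 1) / 2) * (s ^ n * (y ^ n * s) * y) := by
          rw [pow_succ, ih]
          simp only [mul_assoc]
      _ = z ^ (n * (n - 1) / 2) * (z ^ n * s ^ n * (s * y ^ n) * y) := by
          rw [pow_mul_of_commutator_commute h hy, ((hs.pow_left n).pow_right n).eq]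
          simp only [mul_assoc]
      _ = _ := by
          rw [h2, pow_add, pow_succ s, pow_succ y]
          simp only [mul_assoc]

/-- An automorphism of finite `p`-power order stabilizing a cyclic group acts trivially on its
image in the Frattini quotient. -/
theorem dual_apply_eq_of_mem_zpowers {S : Type*} [Group S] {g : MulAut S} {k : ℕ}
    (hg : g ^ p ^ k = 1) {a : S} (ha : g a ∈ Subgroup.zpowers a) (χ : Additive S →+ ZMod p)
    {d : S} (hd : d ∈ Subgroup.zpowers a) : χ (.ofMul (g d)) = χ (.ofMul d) := by
  obtain ⟨u, hu⟩ := ha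
  change a ^ u = g a at hu
  suffices h : χ (.ofMul (g a)) = χ (.ofMul a) by
    obtain ⟨l, rfl⟩ := hd
    change χ (.ofMul (g (a ^ l))) = χ (.ofMul (a ^ l))
    rw [map_zpow, ofMul_zpow, ofMul_zpow, map_zsmul, map_zsmul, h]
  have h1 : ∀ n : ℕ, (g ^ n) a = a ^ u ^ n := by
    intro n
    induction n with
    | zero => simp
    | succ n ih =>
      rw [pow_succ', MulAut.mul_apply, ih, map_zpow, ← hu, ← zpow_mul, pow_succ']
  have h2 : a ^ u ^ p ^ k = a := by rw [← h1, hg, MulAut.one_apply]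
  have h3 := congrArg (fun t => χ (.ofMul t)) h2
  simp only [ofMul_zpow, map_zsmul, zsmul_eq_mul] at h3
  push_cast at h3
  -- By Fermat, `u ^ p ^ k = u` in `ℤ/p`, so `χ a = u χ a`, which is `χ (g a)`.
  rw [ZMod.pow_card_pow] at h3
  rw [← hu, ofMul_zpow, map_zsmul, zsmul_eq_mul, h3]

/-- The configuration around an essential subgroup `S` of a metacyclic `p`-group, `p` odd, which
does not occur: an involution inverting the Frattini quotient of `S` and fixing an element `x` that
normalizes `S` and acts non-trivially on the Frattini quotient. -/
theorem IsPGroup.false_of_involution_fixing [Finite P] (hP : IsPGroup p P) (hp : p ≠ 2)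
    (M : Subgroup P) [M.Normal] [IsCyclic M] [IsCyclic (P ⧸ M)] (S : Subgroup P)
    (x : Subgroup.normalizer (S : Set P)) (hxp : (x : P) ^ p ∈ S)
    (β : MulAut P) (hβx : β x = x) (σ : MulAut S) (hβσ : ∀ s : S, β s = σ s) (hσ2 : σ * σ = 1)
    (hσ : dualAction p S σ = -1) (hne : dualAction p S (S.normalizerMonoidHom x) ≠ 1) :
    False := by
  have hS : IsPGroup p S := hP.to_subgroup S
  set c := S.normalizerMonoidHom with hc
  have hcoe : ∀ (y : Subgroup.normalizer (S : Set P)) (s : S), (c y s : P) = y * s * (y : P)⁻¹ :=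
    fun _ _ => rfl
  let π : P →* P ⧸ M := QuotientGroup.mk' M
  have hπ : ∀ y, π y = 1 ↔ y ∈ M := fun y => QuotientGroup.eq_one_iff y
  have hπc : ∀ y z : P, π y * π z = π z * π y := fun y z => IsCyclic.isMulCommutative.is_comm.comm _ _
  let f : S →* P ⧸ M := π.comp S.subtype
  have hf : ∀ s : S, f s = 1 ↔ (s : P) ∈ M := fun s => hπ s
  have : IsCyclic f.ker := by
    let j : f.ker →* M := (S.subtype.comp f.ker.subtype).codRestrict M fun s => (hf s).1 s.2
    refine isCyclic_of_injective j fun s t h => ?_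
    exact Subtype.ext (Subtype.ext (congrArg (fun t : M => (t : P)) h))
  obtain ⟨χ, b, hχ⟩ : ∃ (χ : Additive S →+ ZMod p) (b : S),
      χ (.ofMul (c x b)) ≠ χ (.ofMul b) := by
    by_contra! h
    exact hne (dualAction_eq_one_iff.2 h)
  have hfc : ∀ (y : Subgroup.normalizer (S : Set P)) (s : S), f (c y s) = f s := by
    intro y s
    change π (y * s * (y : P)⁻¹) = π s
    rw [map_mul, map_mul, map_inv, hπc, mul_inv_cancel_right]
  -- The commutator of `x` and `b` lies in `M` because `P ⧸ M` is abelian. Since `χ a ≠ 0`, it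
  -- generates `S ∩ M`, and `σ a` stays in `M` because `σ` commutes with `c x`.
  set a : S := c x b * b⁻¹ with ha
  have hfa : f a = 1 := by rw [ha, map_mul, hfc, map_inv, mul_inv_cancel]
  have hσx : ∀ s, σ (c x s) = c x (σ s) := fun s => by
    ext
    rw [← hβσ, hcoe, map_mul, map_mul, map_inv, hβx, hβσ, hcoe]
  have hfσa : f (σ a) = 1 := by
    rw [ha, map_mul, map_inv, hσx, map_mul, hfc, map_inv, mul_inv_cancel]
  have hχa : χ (.ofMul a) ≠ 0 := by
    rw [ha, ofMul_mul, ofMul_inv, map_add, map_neg, ← sub_eq_add_neg]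
    exact sub_ne_zero.2 hχ
  obtain ⟨hcomm, hinv⟩ := hS.commute_and_inv_of_dualAction_eq_neg_one hp f hσ2 hσ hfa hfσa hχa
  have hC : f.ker = Subgroup.zpowers a := hS.eq_zpowers_of_dual_ne_zero hfa hχa
  -- The element `x ^ p` of `S` is both fixed and inverted by `σ`, and `p` is odd.
  have hxp1 : (x : P) ^ p = 1 := by
    have h1 : σ ⟨_, hxp⟩ = ⟨_, hxp⟩ := Subtype.ext (by rw [← hβσ, map_pow, hβx])
    rw [hinv] at h1
    have h2 : (⟨_, hxp⟩ : S) ^ (2 : ℤ) = 1 := by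
      rw [zpow_ofNat, sq]
      nth_rewrite 1 [← h1]
      exact inv_mul_cancel _
    exact congrArg Subtype.val (hS.eq_one_of_zpow_eq_one (not_prime_dvd_two hp) h2)
  have hle : Subgroup.zpowers (x : P) ≤ Subgroup.normalizer (S : Set P) :=
    Subgroup.zpowers_le.2 x.2
  set N := S ⊔ Subgroup.zpowers (x : P) with hN
  have hNn : N ≤ Subgroup.normalizer (S : Set P) := sup_le Subgroup.le_normalizer hle
  have hNmem : ∀ y ∈ N, ∃ s ∈ S, ∃ i : ℤ, s * (x : P) ^ i = y := by
    intro y hy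
    rw [← SetLike.mem_coe, hN, Subgroup.coe_mul_of_right_le_normalizer_left _ _ hle] at hy
    obtain ⟨s, hs, _, ⟨i, rfl⟩, h⟩ := hy
    exact ⟨s, hs, i, h⟩
  have hxN : (x : P) ∈ N := (le_sup_right : _ ≤ N) (Subgroup.mem_zpowers _)
  have hSN : S ≤ N := le_sup_left
  have hcp : ∀ y : Subgroup.normalizer (S : Set P), ∃ k : ℕ, c y ^ p ^ k = 1 := fun y => by
    obtain ⟨k, hk⟩ := hP y
    exact ⟨k, by rw [← map_pow, show y ^ p ^ k = 1 from Subtype.ext hk, map_one]⟩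
  have hχc : ∀ (y : Subgroup.normalizer (S : Set P)) (d : S), f d = 1 →
      χ (.ofMul (c y d)) = χ (.ofMul d) := fun y d hd => by
    obtain ⟨k, hk⟩ := hcp y
    refine dual_apply_eq_of_mem_zpowers hk (a := a) ?_ χ ?_
    · rw [← hC, MonoidHom.mem_ker, hfc, hfa]
    · rw [← hC, MonoidHom.mem_ker, hd]
  obtain ⟨m, hm⟩ : ∃ m, Subgroup.zpowers m = M ⊓ N := by
    have : IsCyclic (M ⊓ N : Subgroup P) :=
      isCyclic_of_injective (Subgroup.inclusion (inf_le_left : M ⊓ N ≤ M))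
        (Subgroup.inclusion_injective _)
    exact (Subgroup.isCyclic_iff_exists_zpowers_eq_top _).1 this
  have hmMN : m ∈ M ⊓ N := hm ▸ Subgroup.mem_zpowers m
  -- If `M ⊓ N ≤ S`, then `x = n ^ i * d` and `b = n ^ k * e` with `d`, `e` in `⟨a⟩`. The powers of
  -- `n` commute and `d` centralizes the abelian `S`, so `x` only moves `e`, and `χ` does not see
  -- that.
  by_cases hmS : m ∈ S
  · have hMNS : M ⊓ N ≤ S := hm ▸ Subgroup.zpowers_le.2 hmS
    obtain ⟨n', hn'⟩ : ∃ n, Subgroup.zpowers n = N.map π :=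
      (Subgroup.isCyclic_iff_exists_zpowers_eq_top _).1 inferInstance
    obtain ⟨n, hnN, rfl⟩ : n' ∈ N.map π := hn' ▸ Subgroup.mem_zpowers n'
    have hgen : ∀ y ∈ N, ∃ i : ℤ, ∃ d : S, f d = 1 ∧ y = n ^ i * d := by
      intro y hy
      obtain ⟨i, hi⟩ : π y ∈ Subgroup.zpowers (π n) := hn' ▸ ⟨y, hy, rfl⟩
      change π n ^ i = π y at hi
      have h1 : (n ^ i)⁻¹ * y ∈ M := by
        rw [← hπ, map_mul, map_inv, map_zpow, hi, inv_mul_cancel]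
      refine ⟨i, ⟨_, hMNS (Subgroup.mem_inf.2
        ⟨h1, mul_mem (inv_mem (zpow_mem hnN i)) hy⟩)⟩, (hf _).2 h1, ?_⟩
      group
    obtain ⟨i, d, hd, hxd⟩ := hgen x hxN
    obtain ⟨k, e, he, hbe⟩ := hgen b (hSN b.2)
    let y : Subgroup.normalizer (S : Set P) := ⟨n ^ i, hNn (zpow_mem hnN i)⟩
    let r : S := ⟨n ^ k, by
      rw [eq_mul_inv_of_mul_eq hbe.symm]
      exact mul_mem b.2 (inv_mem e.2)⟩
    have hbr : b = r * e := Subtype.ext hbe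
    have h1 : c x b = r * c y e := by
      have h2 : (d : P) * (r * e : P) * (d : P)⁻¹ = r * e := by
        have := hcomm d (r * e)
        rw [← mul_inv_eq_iff_eq_mul] at this
        exact congrArg Subtype.val this
      ext
      rw [hcoe, hxd, hbe]
      change n ^ i * d * (r * e) * (n ^ i * (d : P))⁻¹ = n ^ k * (n ^ i * e * (n ^ i)⁻¹)
      calc n ^ i * d * (r * e) * (n ^ i * (d : P))⁻¹
          = n ^ i * (d * (r * e) * (d : P)⁻¹) * (n ^ i)⁻¹ := by group
        _ = n ^ k * (n ^ i * e * (n ^ i)⁻¹) := by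
          rw [h2]
          change n ^ i * (n ^ k * e) * (n ^ i)⁻¹ = _
          group
    apply hχ
    rw [h1, hbr, ofMul_mul, ofMul_mul, map_add, map_add, hχc y e he]
  -- If `m = s * y ∉ S` with `y` a power of `x`, the aim is `m ^ p = s ^ p`. Then `a`, a power of `m
  -- ^ p`, is a `p`-th power in `S`, against `χ a ≠ 0`.
  · obtain ⟨s, hs, i, hsm⟩ := hNmem m hmMN.2
    set y : P := (x : P) ^ i with hy
    have hyp : y ^ p = 1 := by
      rw [hy, ← zpow_natCast, ← zpow_mul, mul_comm, zpow_mul, zpow_natCast, hxp1, one_zpow]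
    have hyS : y ∉ S := fun h => hmS (hsm ▸ mul_mem hs h)
    have hyn : y ∈ Subgroup.normalizer (S : Set P) := zpow_mem x.2 i
    obtain ⟨j, hj⟩ : (a : P) ∈ Subgroup.zpowers m := hm ▸ ⟨(hf a).1 hfa, hSN a.2⟩
    change m ^ j = a at hj
    have ham : Commute (a : P) m := hj ▸ (Commute.refl m).zpow_left j
    have has : Commute (a : P) s := congrArg Subtype.val (hcomm a ⟨s, hs⟩)
    have hay : Commute (a : P) y := by
      have : y = s⁻¹ * m := by rw [← hsm]; group
      rw [this]
      exact has.inv_right.mul_right ham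
    set z : S := c ⟨y, hyn⟩ ⟨s, hs⟩ * (⟨s, hs⟩)⁻¹ with hz
    obtain ⟨l, hl⟩ : z ∈ Subgroup.zpowers a := by
      rw [← hC, MonoidHom.mem_ker, hz, map_mul, hfc, map_inv, mul_inv_cancel]
    have hl' : (z : P) = (a : P) ^ l := congrArg Subtype.val hl.symm
    have hzs : Commute (z : P) s := hl' ▸ has.zpow_left l
    have hzy : Commute (z : P) y := hl' ▸ hay.zpow_left l
    have hys : y * s = z * (s * y) := by
      change y * s = (y * s * y⁻¹ * s⁻¹) * (s * y)
      group
    have hzp : (z : P) ^ p = 1 := by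
      have := pow_mul_of_commutator_commute hys hzy p
      rwa [hyp, one_mul, mul_one, right_eq_mul] at this
    -- For odd `p` the exponent `p * (p - 1) / 2` is a multiple of `p`, which kills `z`.
    have hmp : m ^ p = s ^ p := by
      obtain ⟨t, ht⟩ := (Fact.out : p.Prime).odd_of_ne_two hp
      have h1 : p * (p - 1) / 2 = p * t := by
        rw [show p - 1 = t * 2 by omega, ← mul_assoc, Nat.mul_div_cancel _ two_pos]
      rw [← hsm, mul_pow_of_commutator_commute hys hzs hzy, h1, pow_mul, hzp, one_pow, one_mul,
        hyp, mul_one]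
    -- Both `m ^ j = a` and `m ^ p = s ^ p` lie in `S`; coprime exponents would put `m` itself in
    -- `S`.
    have hpj : (p : ℤ) ∣ j := by
      by_contra hpj
      obtain ⟨u, v, huv⟩ := (Nat.prime_iff_prime_int.1 Fact.out).coprime_iff_not_dvd.2 hpj
      apply hmS
      rw [← zpow_one m, ← huv, zpow_add, mul_comm, mul_comm v, zpow_mul, zpow_mul, hj,
        zpow_natCast, hmp]
      exact mul_mem (zpow_mem (pow_mem hs p) u) (zpow_mem a.2 v)
    obtain ⟨t, rfl⟩ := hpj
    have has' : a = (⟨s, hs⟩ : S) ^ ((p : ℤ) * t) := by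
      ext
      rw [← hj, zpow_mul, zpow_natCast, hmp, Subgroup.coe_zpow, zpow_mul, zpow_natCast]
    apply hχa
    rw [has', ofMul_zpow, map_zsmul, zsmul_eq_mul]
    simp

end Normalizer

/-! ### Extending the automorphisms of a proper subgroup. -/

section Essential

variable {p : ℕ} [Fact p.Prime] {P : Type*} [Group P]

/-- If an automorphism `α` of a group of odd order `n` satisfies `α x ∈ x S` for an `α`-invariant
subgroup `S` on which `α` is an involution, then a power of `α` with the same restriction to `S`
fixes an element of `x S`. -/
theorem exists_fixed_mul_of_involution {S : Subgroup P} {n : ℕ} (hn : Odd n)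
    (hPn : ∀ y : P, y ^ n = 1) {α : MulAut P} (hαS : ∀ s ∈ S, α s ∈ S)
    (hα2 : ∀ s ∈ S, α (α s) = s) {x : P} (hx : x⁻¹ * α x ∈ S) :
    ∃ β : MulAut P, (∀ s ∈ S, β s = α s) ∧ ∃ r ∈ S, β (x * r) = x * r := by
  have hα2n : ∀ (m : ℕ), ∀ s ∈ S, ((α * α) ^ m) s = s := by
    intro m s hs
    induction m with
    | zero => rfl
    | succ m ih => rw [pow_succ, MulAut.mul_apply, MulAut.mul_apply, hα2 s hs, ih]
  obtain ⟨t, ht⟩ := hn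
  have hw : x⁻¹ * α (α x) ∈ S := by
    have := mul_mem hx (hαS _ hx)
    rwa [map_mul, map_inv, mul_assoc, mul_inv_cancel_left] at this
  have hx2 : ∀ m : ℕ, ((α * α) ^ m) x = x * (x⁻¹ * α (α x)) ^ m := by
    intro m
    induction m with
    | zero => simp
    | succ m ih =>
      have h1 : (α * α) x = x * (x⁻¹ * α (α x)) := by
        rw [mul_inv_cancel_left]; rfl
      rw [pow_succ, MulAut.mul_apply, h1, map_mul, ih, hα2n m _ hw, pow_succ, mul_assoc]
  have hβ : α ^ n = (α * α) ^ t * α := by rw [ht, pow_succ, pow_mul, sq]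
  have hβS : ∀ s ∈ S, (α ^ n) s = α s := fun s hs => by
    rw [hβ, MulAut.mul_apply, hα2n t _ (hαS s hs)]
  refine ⟨α ^ n, hβS, ?_⟩
  set β := α ^ n with hβdef
  -- As `α²` is trivial on `S` and sends `x` to `x * w` with `w ∈ S`, `α ^ (2 * n)` sends `x` to `x
  -- * w ^ n = x`.
  have hββ : β (β x) = x := by
    have h1 := hx2 n
    rw [hPn, mul_one, ← sq, ← pow_mul, mul_comm, pow_mul, sq] at h1
    exact h1
  have hq : x⁻¹ * β x ∈ S := by
    have h1 : β x = α x * α (x⁻¹ * α (α x)) ^ t := by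
      rw [hβ, (((Commute.refl α).mul_left (Commute.refl α)).pow_left t).eq, MulAut.mul_apply, hx2,
        map_mul, map_pow]
    rw [h1, ← mul_assoc]
    exact mul_mem hx (pow_mem (hαS _ hw) t)
  set q := x⁻¹ * β x with hqdef
  have hβx : β x = x * q := by rw [hqdef, mul_inv_cancel_left]
  have hβq : β q = q⁻¹ := by
    rw [hqdef, map_mul, hββ, map_inv, mul_inv_rev, inv_inv]
  -- Here `β x = x * q` and `β q = q⁻¹`, so a square root of `q` corrects `x`. Since `q ^ (2 * t +
  -- 1) = 1`, that root is `q ^ (t + 1)`.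
  refine ⟨q ^ (t + 1), pow_mem hq _, ?_⟩
  have h2 : q ^ (t + 1) * q ^ (t + 1) = q := by
    rw [← pow_add, show t + 1 + (t + 1) = n + 1 by omega, pow_succ, hPn, one_mul]
  rw [map_mul, map_pow, hβq, hβx, inv_pow, mul_assoc, mul_right_inj, mul_inv_eq_iff_eq_mul, h2]

/-- Let `S` be a proper subgroup of a metacyclic `p`-group `P`, `p` odd, and `G` a group of
automorphisms of `S` having `Aut_P(S)` as a Sylow subgroup. If all elements of `G` which carry some
automorphism induced by an element outside `S` to an element of `Aut_P(S)` extend to `P`, then all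
elements of `G` do. -/
theorem IsMetacyclic.forall_extends [Finite P] (hmeta : IsMetacyclic P) (hP : IsPGroup p P)
    (hp : p ≠ 2) {S : Subgroup P} (hSt : S ≠ ⊤) {G : Subgroup (MulAut S)} (T : Sylow p G)
    (hT : (T : Subgroup G) = S.normalizerMonoidHom.range.subgroupOf G)
    (hTG : S.normalizerMonoidHom.range ≤ G) {A : Subgroup (MulAut P)}
    (hE : ∀ g ∈ G, ∀ x y : Subgroup.normalizer (S : Set P), (x : P) ∉ S →
      g * S.normalizerMonoidHom x = S.normalizerMonoidHom y * g →
      ∃ α ∈ A, ∀ s : S, α s = g s) :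
    ∀ g ∈ G, ∃ α ∈ A, ∀ s : S, α s = g s := by
  intro g hg
  by_contra hgE
  have hS : IsPGroup p S := hP.to_subgroup S
  obtain ⟨M, hM, hMc, hMq⟩ := hmeta
  set c := S.normalizerMonoidHom with hc
  have hcoe : ∀ (y : Subgroup.normalizer (S : Set P)) (s : S), (c y s : P) = y * s * (y : P)⁻¹ :=
    fun _ _ => rfl
  have hcG : ∀ x, c x ∈ G := fun x => hTG ⟨x, rfl⟩
  have hg1 : ∀ x y, g * c x = c y * g → (x : P) ∈ S := fun x y h => by
    by_contra hx
    exact hgE (hE g hg x y hx h)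
  -- The kernel is a normal `p`-subgroup of `G`, hence lies in every Sylow subgroup, in particular
  -- in `Aut_P(S)`.
  have hK : ∀ k ∈ G, dualAction p S k = 1 → ∃ y, c y = k := by
    intro k hk hk1
    have hpg : IsPGroup p ((dualAction p S).ker.subgroupOf G) :=
      hS.ker_dualAction.comap_of_injective G.subtype G.subtype_injective
    have h1 : (⟨k, hk⟩ : G) ∈ (T : Subgroup G) := hpg.le_sylow_of_normal T hk1
    rw [hT] at h1
    exact h1
  -- Conjugation by `g` keeps `k` in the kernel, hence in `Aut_P(S)`, so `hg1` makes `k` inner.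
  have hKS : ∀ k ∈ G, dualAction p S k = 1 →
      ∃ y : Subgroup.normalizer (S : Set P), (y : P) ∈ S ∧ c y = k := by
    intro k hk hk1
    obtain ⟨x, hx⟩ := hK k hk hk1
    obtain ⟨y, hy⟩ := hK (g * k * g⁻¹) (mul_mem (mul_mem hg hk) (inv_mem hg)) (by
      rw [map_mul, map_mul, hk1, mul_one, ← map_mul, mul_inv_cancel, map_one])
    exact ⟨x, hg1 x y (by rw [hx, hy]; group), hx⟩
  have hcent : ∀ x : Subgroup.normalizer (S : Set P), c x = 1 → (x : P) ∈ S := fun x hx =>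
    hg1 x 1 (by rw [hx, map_one, mul_one, one_mul])
  have hne : ∀ x : Subgroup.normalizer (S : Set P), (x : P) ∉ S → dualAction p S (c x) ≠ 1 := by
    intro x hx h
    obtain ⟨y, hy, hxy⟩ := hKS _ (hcG x) h
    apply hx
    have h1 : c (x * y⁻¹) = 1 := by rw [map_mul, map_inv, hxy, mul_inv_cancel]
    have h2 := mul_mem (hcent _ h1) hy
    simpa using h2
  have := hP.isNilpotent
  obtain ⟨x₀, hx₀, hx₀S⟩ := SetLike.exists_of_lt
    (Group.normalizerCondition_of_isNilpotent S (lt_top_iff_ne_top.2 hSt))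
  let x : Subgroup.normalizer (S : Set P) := ⟨x₀, hx₀⟩
  have hxpow : ∃ k : ℕ, c x ^ p ^ k = 1 := by
    obtain ⟨k, hk⟩ := hP x₀
    exact ⟨k, by rw [← map_pow, show x ^ p ^ k = 1 from Subtype.ext hk, map_one]⟩
  obtain ⟨k, hk⟩ := hxpow
  have hrank : Module.finrank (ZMod p) (Additive S →+ ZMod p) ≤ 2 := by
    let f : S →* P ⧸ M := (QuotientGroup.mk' M).comp S.subtype
    have : IsCyclic f.ker := by
      let j : f.ker →* M := (S.subtype.comp f.ker.subtype).codRestrict M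
        fun s => (QuotientGroup.eq_one_iff (s : P)).1 s.2
      refine isCyclic_of_injective j fun s t h => ?_
      exact Subtype.ext (Subtype.ext (congrArg (fun t : M => (t : P)) h))
    obtain ⟨a, b, hab⟩ := exists_closure_pair_eq_top f
    exact finrank_dual_le_two hab
  have hcx : g * c x * g⁻¹ ∈ G := mul_mem (mul_mem hg (hcG x)) (inv_mem hg)
  obtain ⟨σ₀, hσ₀G, hσ₀⟩ : -1 ∈ G.toSubmonoid.map (dualAction p S) := by
    have : Module.Finite (ZMod p) (Additive S →+ ZMod p) := by
      have : Finite (Additive S →+ ZMod p) :=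
        Finite.of_injective (fun f : Additive S →+ ZMod p => (f : Additive S → ZMod p))
          DFunLike.coe_injective
      infer_instance
    refine neg_one_mem_of_unipotent hrank _ (τ := dualAction p S (c x))
      (τ' := dualAction p S (g * c x * g⁻¹)) ⟨_, hcG x, rfl⟩
      ⟨_, hcx, rfl⟩ (k := k) (k' := k)
      (by rw [← map_pow, hk, map_one])
      (by rw [← map_pow, conj_pow, hk, mul_one, mul_inv_cancel, map_one])
      (hne x hx₀S) fun n hn => ?_
    -- If the second unipotent were a power of the first, `g * c x * g⁻¹` would agree with `c x ^ n`
    -- up to the kernel and so lie in `Aut_P(S)`, against `hg1`.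
    obtain ⟨y, hy⟩ := hK (g * c x * g⁻¹ * (c x ^ n)⁻¹)
      (mul_mem hcx (inv_mem (pow_mem (hcG x) n))) (by
        rw [map_mul, hn, ← map_pow, ← map_mul, mul_inv_cancel, map_one])
    refine hx₀S (hg1 x (y * x ^ n) ?_)
    rw [map_mul, map_pow, hy]
    group
  change σ₀ ∈ G at hσ₀G
  have hpodd : Odd p := (Fact.out : p.Prime).odd_of_ne_two hp
  obtain ⟨σ, hσG, hσ, hσ2⟩ : ∃ σ ∈ G, dualAction p S σ = -1 ∧ σ * σ = 1 := by
    -- The square of `σ₀` lies in the kernel, so it has `p`-power order. An odd power of `σ₀` is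
    -- then an involution that still acts as `-1`.
    obtain ⟨m, hm⟩ := hS.ker_dualAction (⟨σ₀ * σ₀, by
      rw [MonoidHom.mem_ker, map_mul, hσ₀]
      exact Module.End.neg_one_mul_neg_one⟩ : (dualAction p S).ker)
    have hm' : (σ₀ * σ₀) ^ p ^ m = 1 := congrArg Subtype.val hm
    refine ⟨σ₀ ^ p ^ m, pow_mem hσ₀G _, ?_, ?_⟩
    · rw [map_pow, hσ₀]
      exact Module.End.neg_one_pow_of_odd hpodd.pow
    · rw [← (Commute.refl σ₀).mul_pow, hm']
  have hσσ : ∀ s, σ (σ s) = s := fun s => DFunLike.congr_fun hσ2 s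
  -- As `-1` is central, this commutator lies in the kernel and is inner. So `σ` conjugates `c x` to
  -- `c (z * x)`, and `hE` applies to `σ`.
  obtain ⟨z, hzS, hz⟩ := hKS (σ * c x * σ⁻¹ * (c x)⁻¹)
    (mul_mem (mul_mem (mul_mem hσG (hcG x)) (inv_mem hσG)) (inv_mem (hcG x))) (by
      have h1 : dualAction p S (σ * c x) = dualAction p S (c x * σ) := by
        rw [map_mul, map_mul, hσ]
        exact Module.End.neg_one_mul_eq_mul_neg_one _
      rw [mul_assoc, ← mul_inv_rev, map_mul, h1, ← map_mul, mul_inv_cancel, map_one])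
  have hσx : σ * c x = c (z * x) * σ := by
    rw [map_mul, hz]
    group
  obtain ⟨α, -, hα⟩ := hE σ hσG x (z * x) hx₀S hσx
  have hαS : ∀ s ∈ S, α s ∈ S := fun s hs => by
    rw [hα ⟨s, hs⟩]
    exact (σ _).2
  have hα2 : ∀ s ∈ S, α (α s) = s := fun s hs => by
    rw [hα ⟨s, hs⟩, hα, hσσ]
  -- Both `α x₀` and `z * x₀` induce the same automorphism of `S`, so they differ by an element of
  -- `C_P(S) ≤ S`.
  have hαx : x₀⁻¹ * α x₀ ∈ S := by
    have h1 : ∀ s : S, (α x₀) * s * (α x₀)⁻¹ = c (z * x) s := by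
      intro s
      have h2 := DFunLike.congr_fun hσx (σ s)
      rw [MulAut.mul_apply, MulAut.mul_apply, hσσ] at h2
      rw [← h2, ← hα, hcoe, map_mul, map_mul, map_inv, hα, hσσ]
    have h2 : ((z * x : Subgroup.normalizer (S : Set P)) : P)⁻¹ * α x₀ ∈
        Subgroup.centralizer (S : Set P) := by
      intro s hs
      have h3 := h1 ⟨s, hs⟩
      rw [hcoe, mul_inv_eq_iff_eq_mul] at h3
      rw [mul_assoc, h3]
      group
    have h3 : ((z * x : Subgroup.normalizer (S : Set P)) : P)⁻¹ * α x₀ ∈ S :=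
      hcent ⟨_, Subgroup.centralizer_le_normalizer _ h2⟩ (by
        rw [← MonoidHom.mem_ker, hc, Subgroup.normalizerMonoidHom_ker]
        exact h2)
    have h4 : x₀⁻¹ * z * x₀⁻¹⁻¹ ∈ S :=
      (Subgroup.mem_normalizer_iff.1 (inv_mem hx₀) _).1 hzS
    have h5 := mul_mem h4 h3
    have h6 : x₀⁻¹ * z * x₀⁻¹⁻¹ * (((z * x : Subgroup.normalizer (S : Set P)) : P)⁻¹ * α x₀) =
        x₀⁻¹ * α x₀ := by
      change x₀⁻¹ * z * x₀⁻¹⁻¹ * ((z * x₀ : P)⁻¹ * α x₀) = _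
      group
    rwa [h6] at h5
  have hodd : Odd (Nat.card P) := by
    obtain ⟨n, hn⟩ := IsPGroup.iff_card.1 hP
    rw [hn]
    exact hpodd.pow
  obtain ⟨β, hβS, r, hr, hβr⟩ :=
    exists_fixed_mul_of_involution hodd (fun y => pow_card_eq_one') hαS hα2 hαx
  let w : Subgroup.normalizer (S : Set P) := x * ⟨r, Subgroup.le_normalizer hr⟩
  have hwS : (w : P) ∉ S := fun h => hx₀S ((Subgroup.mul_mem_cancel_right _ hr).1 h)
  classical
  -- The last power `w ^ p ^ j` outside `S` has its `p`-th power in `S` and is still fixed by `β`.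
  have hex : ∃ j : ℕ, (w : P) ^ p ^ j ∈ S := by
    obtain ⟨j, hj⟩ := hP w
    exact ⟨j, hj ▸ one_mem S⟩
  obtain ⟨j, hj⟩ : ∃ j, Nat.find hex = j + 1 := Nat.exists_eq_succ_of_ne_zero fun h => by
    have := Nat.find_spec hex
    rw [h, pow_zero, pow_one] at this
    exact hwS this
  have hj1 : (w : P) ^ p ^ j ∉ S := Nat.find_min hex (by omega)
  have hj2 : (w : P) ^ p ^ (j + 1) ∈ S := hj ▸ Nat.find_spec hex
  refine hP.false_of_involution_fixing hp M S (w ^ p ^ j) ?_ β ?_ σ ?_ hσ2 hσ ?_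
  · rw [Subgroup.coe_pow, ← pow_mul, ← pow_succ]
    exact hj2
  · rw [Subgroup.coe_pow, map_pow]
    exact congrArg (· ^ p ^ j) hβr
  · intro s
    rw [hβS s s.2, hα]
  · exact hne _ (by rwa [Subgroup.coe_pow])

end Essential

/-! ### Saturated fusion systems: extension to `P` and the complement `A`. -/

namespace FusionSystem

variable {p : ℕ} {P : Type*} [Group P] {F : FusionSystem P}

/-- `Aut_F(P)`, as a group of automorphisms of `P` itself. -/
def autWhole (F : FusionSystem P) : Subgroup (MulAut P) :=
  (F.autGroup ⊤).comap (MulAut.congr (Subgroup.topEquiv (G := P)).symm).toMonoidHom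

theorem exists_mem_autWhole [Finite P] {φ : (⊤ : Subgroup P) →* (⊤ : Subgroup P)}
    (hφ : φ ∈ F.hom ⊤ ⊤) : ∃ α ∈ F.autWhole, ∀ x : (⊤ : Subgroup P), (φ x : P) = α x := by
  let e : MulAut (⊤ : Subgroup P) :=
    MulEquiv.ofBijective φ (Finite.injective_iff_bijective.1 (F.injective hφ))
  refine ⟨MulAut.congr Subgroup.topEquiv e, ?_, fun x => rfl⟩
  exact hφ

theorem mem_hom_of_mem_autWhole {α : MulAut P} (hα : α ∈ F.autWhole) {Q R : Subgroup P}
    {φ : Q →* R} (h : ∀ x : Q, (φ x : P) = α x) : φ ∈ F.hom Q R := by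
  have h1 : Subgroup.inclusion (le_top : Q ≤ ⊤) ∈ F.hom _ _ := F.conj_mem _ 1 (by simp)
  exact F.mem_of_eq (F.comp_mem h1 hα) φ h

theorem conj_mem_autWhole (F : FusionSystem P) (g : P) : MulAut.conj g ∈ F.autWhole :=
  F.conj_mem _ g fun _ => rfl

/-- All morphisms with source `Q` are restrictions of elements of `Aut_F(P)`. -/
def ExtendsFrom (F : FusionSystem P) (Q : Subgroup P) : Prop :=
  ∀ φ ∈ F.hom Q ⊤, ∃ α ∈ F.autWhole, ∀ x : Q, (φ x : P) = α x

theorem ExtendsFrom.exists_mem_autWhole {Q R : Subgroup P} (h : F.ExtendsFrom Q) {φ : Q →* R}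
    (hφ : φ ∈ F.hom Q R) : ∃ α ∈ F.autWhole, ∀ x : Q, (φ x : P) = α x :=
  h ((Subgroup.inclusion le_top).comp φ) (F.mem_of_eq hφ _ fun _ => rfl)

theorem IsConj.trans {Q R S : Subgroup P} (h : F.IsConj Q R) (h' : F.IsConj R S) :
    F.IsConj Q S := by
  obtain ⟨φ, hφ⟩ := h
  obtain ⟨ψ, hψ⟩ := h'
  exact ⟨φ.trans ψ, F.comp_mem hφ hψ⟩

theorem exists_isFullyNormalized [Finite P] (F : FusionSystem P) (Q : Subgroup P) :
    ∃ S, F.IsConj Q S ∧ F.IsFullyNormalized S := by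
  have hne : {S | F.IsConj Q S}.Nonempty := ⟨Q, MulEquiv.refl Q, F.conj_mem _ 1 (by simp)⟩
  obtain ⟨S, hS, hmax⟩ := Set.exists_max_image {S | F.IsConj Q S}
    (fun S => Nat.card (Subgroup.normalizer (S : Set P))) (Set.toFinite _) hne
  exact ⟨S, hS, fun R hR => hmax R (hS.trans hR)⟩

theorem conjAutGroup_le_autGroup (F : FusionSystem P) (S : Subgroup P) :
    conjAutGroup S ≤ F.autGroup S := by
  rintro _ ⟨x, rfl⟩
  exact F.conj_mem _ (x : P) fun _ => rfl

/-- An isomorphism onto a fully normalized subgroup extends to `P` if it extends to a subgroup on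
which all morphisms do. -/
theorem IsSaturated.exists_mem_autWhole_of_extender (hF : F.IsSaturated p)
    {Q S : Subgroup P} (hS : F.IsFullyNormalized S) {e : Q ≃* S}
    (he : e.toMonoidHom ∈ F.hom Q S) {x : Subgroup.normalizer (Q : Set P)}
    (hx : ∃ y : Subgroup.normalizer (S : Set P), ∀ u : Q,
      e (Q.normalizerMonoidHom x u) = S.normalizerMonoidHom y (e u))
    (hext : ∀ R : Subgroup P, Q ≤ R → (x : P) ∈ R → F.ExtendsFrom R) :
    ∃ α ∈ F.autWhole, ∀ u : Q, (e u : P) = α u := by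
  let φ : Q →* (⊤ : Subgroup P) := (Subgroup.inclusion le_top).comp e.toMonoidHom
  have hφ : φ ∈ F.hom Q ⊤ := F.mem_of_eq he _ fun _ => rfl
  have hrange : ((⊤ : Subgroup P).subtype.comp φ).range = S := by
    ext s
    constructor
    · rintro ⟨u, rfl⟩
      exact (e u).2
    · intro hs
      refine ⟨e.symm ⟨s, hs⟩, ?_⟩
      change ((e (e.symm ⟨s, hs⟩) : S) : P) = s
      rw [e.apply_symm_apply]
  obtain ⟨ψ, hψ, hψφ⟩ := hF.extension Q φ hφ (by
    rw [hrange]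
    exact hF.fullyCentralized S hS)
  obtain ⟨y, hy⟩ := hx
  have hxe : (x : P) ∈ extender φ := by
    refine ⟨x.2, y, by rw [hrange]; exact y.2, fun u v huv => ?_⟩
    have : v = Q.normalizerMonoidHom x u := Subtype.ext huv
    rw [this]
    exact congrArg Subtype.val (hy u)
  obtain ⟨α, hα, h⟩ := hext _ (le_extender φ) hxe ψ hψ
  refine ⟨α, hα, fun u => ?_⟩
  exact (congrArg Subtype.val (DFunLike.congr_fun hψφ u).symm).trans
    (h (Subgroup.inclusion (le_extender φ) u))

variable [Fact p.Prime]

theorem card_lt_card_of_le_of_mem [Finite P] {Q R : Subgroup P} (h : Q ≤ R) {x : P} (hx : x ∈ R)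
    (hxQ : x ∉ Q) : Nat.card Q < Nat.card R := by
  have : (Q : Set P) ⊂ R := Set.ssubset_iff_exists.2 ⟨h, x, hx, hxQ⟩
  exact Set.ncard_lt_ncard this

/-- By Sylow's theorem in `Aut_F(S)`, an isomorphism `Q → S` can be adjusted so that it carries
`Aut_P(Q)` into `Aut_P(S)`. Its extender then contains an element of `N_P(Q)` outside `Q`. -/
theorem IsSaturated.exists_mulEquiv_extends [Finite P] (hP : IsPGroup p P) (hF : F.IsSaturated p)
    {Q S : Subgroup P} (hS : F.IsFullyNormalized S) (hQS : F.IsConj Q S) (hQ : Q ≠ ⊤)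
    (hext : ∀ R : Subgroup P, Nat.card Q < Nat.card R → F.ExtendsFrom R) :
    ∃ e : Q ≃* S, e.toMonoidHom ∈ F.hom Q S ∧ ∃ α ∈ F.autWhole, ∀ u : Q, (e u : P) = α u := by
  obtain ⟨φ, hφ⟩ := hQS
  obtain ⟨T, hT⟩ := hF.sylow S hS
  let D : Subgroup (MulAut S) := (conjAutGroup Q).map (MulAut.congr φ).toMonoidHom
  have hD : IsPGroup p D := by
    have h1 : IsPGroup p (conjAutGroup Q) :=
      (hP.to_subgroup _).of_surjective _ (Q.normalizerMonoidHom.rangeRestrict_surjective)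
    exact h1.map _
  have hDG : D ≤ F.autGroup S := by
    rintro _ ⟨d, hd, rfl⟩
    exact F.comp_mem (F.comp_mem (F.symm_mem hφ) (F.conjAutGroup_le_autGroup Q hd)) hφ
  obtain ⟨T', hT'⟩ := (hD.comap_of_injective (F.autGroup S).subtype
    (F.autGroup S).subtype_injective).exists_le_sylow
  obtain ⟨γ, hγ⟩ := MulAction.exists_smul_eq (F.autGroup S) T' T
  let e : Q ≃* S := φ.trans (γ : MulAut S)
  have he : e.toMonoidHom ∈ F.hom Q S := F.comp_mem hφ γ.2
  refine ⟨e, he, ?_⟩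
  have := hP.isNilpotent
  obtain ⟨x, hx, hxQ⟩ := SetLike.exists_of_lt
    (Group.normalizerCondition_of_isNilpotent Q (lt_top_iff_ne_top.2 hQ))
  refine hF.exists_mem_autWhole_of_extender hS he (x := ⟨x, hx⟩) ?_
    fun R hR hxR => hext R (card_lt_card_of_le_of_mem hR hxR hxQ)
  let d : MulAut S := MulAut.congr φ (Q.normalizerMonoidHom ⟨x, hx⟩)
  have hdD : d ∈ D := ⟨_, ⟨⟨x, hx⟩, rfl⟩, rfl⟩
  have h1 : (γ * ⟨d, hDG hdD⟩ * γ⁻¹ : F.autGroup S) ∈ (T : Subgroup (F.autGroup S)) := by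
    rw [← hγ]
    exact Subgroup.smul_mem_pointwise_smul (⟨d, hDG hdD⟩ : F.autGroup S) (MulAut.conj γ)
      (T' : Subgroup (F.autGroup S)) (hT' hdD)
  rw [hT] at h1
  obtain ⟨y, hy⟩ := h1
  refine ⟨y, fun u => ?_⟩
  rw [hy]
  change (γ : MulAut S) (φ (Q.normalizerMonoidHom ⟨x, hx⟩ u)) =
    (γ : MulAut S) (φ (Q.normalizerMonoidHom ⟨x, hx⟩
      (φ.symm ((γ : MulAut S)⁻¹ ((γ : MulAut S) (φ u))))))
  rw [MulAut.inv_apply_self, φ.symm_apply_apply]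

theorem IsSaturated.autGroup_extends [Finite P] (hP : IsPGroup p P) (hp : p ≠ 2)
    (hmeta : IsMetacyclic P) (hF : F.IsSaturated p) {S : Subgroup P} (hS : F.IsFullyNormalized S)
    (hSt : S ≠ ⊤) (hext : ∀ R : Subgroup P, Nat.card S < Nat.card R → F.ExtendsFrom R) :
    ∀ g ∈ F.autGroup S, ∃ α ∈ F.autWhole, ∀ s : S, α s = g s := by
  obtain ⟨T, hT⟩ := hF.sylow S hS
  refine hmeta.forall_extends hP hp hSt T hT (F.conjAutGroup_le_autGroup S)
    fun g hg x y hx hxy => ?_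
  obtain ⟨α, hα, h⟩ := hF.exists_mem_autWhole_of_extender hS (e := g) hg (x := x)
    ⟨y, fun u => DFunLike.congr_fun hxy u⟩
    fun R hR hxR => hext R (card_lt_card_of_le_of_mem hR hxR hx)
  exact ⟨α, hα, fun s => (h s).symm⟩

/-- Choose a fully normalized conjugate `S` of `Q` and extendable isomorphisms from `Q` and from
`φ(Q)` to `S`. Between them `φ` becomes an element of `Aut_F(S)`, which extends by
`autGroup_extends`. -/
theorem IsSaturated.extendsFrom [Finite P] (hP : IsPGroup p P) (hp : p ≠ 2)
    (hmeta : IsMetacyclic P) (hF : F.IsSaturated p) (Q : Subgroup P) : F.ExtendsFrom Q := by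
  induction hn : Nat.card P - Nat.card Q using Nat.strong_induction_on generalizing Q with
  | _ n ih =>
  have hext : ∀ R : Subgroup P, Nat.card Q < Nat.card R → F.ExtendsFrom R := fun R hR =>
    ih _ (by have := Subgroup.card_le_card_group R; omega) R rfl
  by_cases hQ : Q = ⊤
  · subst hQ
    exact fun φ hφ => FusionSystem.exists_mem_autWhole hφ
  intro φ hφ
  set R := ((⊤ : Subgroup P).subtype.comp φ).range with hR
  let e : Q ≃* R := MonoidHom.ofInjective (f := (⊤ : Subgroup P).subtype.comp φ)
    (Subtype.val_injective.comp (F.injective hφ))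
  have he : e.toMonoidHom ∈ F.hom Q R := F.mem_of_eq hφ _ fun _ => rfl
  obtain ⟨S, ⟨ψ, hψ⟩, hS⟩ := F.exists_isFullyNormalized Q
  have hcR : Nat.card R = Nat.card Q := Nat.card_congr e.symm.toEquiv
  have hcS : Nat.card S = Nat.card Q := Nat.card_congr ψ.symm.toEquiv
  have hne : ∀ {R : Subgroup P}, Nat.card R = Nat.card Q → R ≠ ⊤ := by
    rintro R h rfl
    exact hQ (Subgroup.eq_top_of_card_eq Q (by rw [← h, Subgroup.card_top]))
  obtain ⟨e₁, he₁, α₁, hα₁, h₁⟩ := hF.exists_mulEquiv_extends hP hS ⟨ψ, hψ⟩ hQ hext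
  obtain ⟨e₂, he₂, α₂, hα₂, h₂⟩ := hF.exists_mulEquiv_extends hP hS
    (Q := R) ⟨e.symm.trans ψ, F.comp_mem (F.symm_mem he) hψ⟩ (hne hcR) (by rwa [hcR])
  obtain ⟨β, hβ, h⟩ := hF.autGroup_extends hP hp hmeta hS (hne hcS) (by rwa [hcS])
    ((e₁.symm.trans e).trans e₂)
    (F.comp_mem (F.comp_mem (F.symm_mem he₁) he) he₂)
  refine ⟨α₂⁻¹ * β * α₁, mul_mem (mul_mem (inv_mem hα₂) hβ) hα₁, fun x => ?_⟩
  rw [MulAut.mul_apply, MulAut.mul_apply, ← h₁, h]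
  change (φ x : P) = α₂⁻¹ (e₂ (e (e₁.symm (e₁ x))) : S)
  rw [e₁.symm_apply_apply, h₂, MulAut.inv_apply_self]
  rfl

theorem eq_normalizer_top (h : ∀ Q, F.ExtendsFrom Q) : F = F.normalizer ⊤ := by
  ext Q R φ
  refine ⟨fun hφ => ⟨hφ, ?_⟩, fun hφ => hφ.1⟩
  obtain ⟨α, hα, hαφ⟩ := (h Q).exists_mem_autWhole hφ
  have htop : ∀ x : P, x ∈ (⊤ ⊔ R : Subgroup P) := fun x => by simp
  let ψ : (⊤ ⊔ Q : Subgroup P) →* (⊤ ⊔ R : Subgroup P) :=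
    (α.toMonoidHom.comp (Subgroup.subtype _)).codRestrict _ fun x => htop _
  refine ⟨ψ, F.mem_hom_of_mem_autWhole hα fun _ => rfl, fun x hx => (hαφ ⟨x, hx⟩).symm, ?_⟩
  ext y
  refine ⟨fun _ => Subgroup.mem_top (y : P), fun _ => ?_⟩
  exact ⟨⟨α⁻¹ y, by simp⟩, Subgroup.mem_top _, Subtype.ext (MulAut.apply_inv_self P α y)⟩

/-- The whole group is fully normalized, so the Sylow axiom makes `Aut_P(P) = Inn(P)` a Sylow
subgroup of `Aut_F(P)`. -/
theorem IsSaturated.not_dvd_index_inner (hF : F.IsSaturated p) [Finite P] :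
    ¬ p ∣ ((MulAut.conj : P →* MulAut P).range.subgroupOf F.autWhole).index := by
  have hN : F.IsFullyNormalized ⊤ := fun R _ => by
    rw [Subgroup.normalizer_eq_top (⊤ : Subgroup P), Subgroup.card_top]
    exact Subgroup.card_le_card_group _
  obtain ⟨T, hT⟩ := hF.sylow ⊤ hN
  let j : F.autWhole →* F.autGroup ⊤ :=
    ((MulAut.congr (Subgroup.topEquiv (G := P)).symm).toMonoidHom.comp
      F.autWhole.subtype).codRestrict _ fun α => α.2
  have hj : Function.Surjective j := fun α =>
    ⟨⟨MulAut.congr Subgroup.topEquiv (α : MulAut (⊤ : Subgroup P)), α.2⟩, rfl⟩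
  have hcomap : (MulAut.conj : P →* MulAut P).range.subgroupOf F.autWhole =
      (T : Subgroup (F.autGroup ⊤)).comap j := by
    rw [hT]
    ext α
    constructor
    · rintro ⟨g, hg⟩
      refine ⟨⟨g, Subgroup.le_normalizer (Subgroup.mem_top g)⟩, ?_⟩
      ext x
      exact DFunLike.congr_fun hg (x : P)
    · rintro ⟨g, hg⟩
      refine ⟨g, ?_⟩
      ext x
      exact congrArg Subtype.val (DFunLike.congr_fun hg (⟨x, Subgroup.mem_top x⟩ : (⊤ : Subgroup P)))
  rw [hcomap, Subgroup.index_comap_of_surjective _ hj]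
  exact T.not_dvd_index

theorem IsSaturated.exists_eq_ofEmbedding [Finite P] (hP : IsPGroup p P) (hF : F.IsSaturated p)
    (h : ∀ Q, F.ExtendsFrom Q) : ∃ A : Subgroup (MulAut P), ¬ p ∣ Nat.card A ∧
      F = ofEmbedding (SemidirectProduct.inl : P →* P ⋊[A.subtype] A)
        SemidirectProduct.inl_injective := by
  set G := F.autWhole with hG
  set I := (MulAut.conj : P →* MulAut P).range.subgroupOf G with hI
  have hIn : I.Normal := by
    refine ⟨?_⟩
    rintro ⟨α, hα⟩ ⟨g, hg⟩ ⟨β, hβ⟩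
    refine ⟨β g, ?_⟩
    change MulAut.conj g = α at hg
    change MulAut.conj (β g) = β * α * β⁻¹
    rw [← hg]
    ext x
    simp
  have hIp : IsPGroup p I :=
    (hP.of_surjective _ (MulAut.conj : P →* MulAut P).rangeRestrict_surjective).comap_of_injective
      G.subtype G.subtype_injective
  have hidx : ¬ p ∣ I.index := hF.not_dvd_index_inner
  obtain ⟨n, hn⟩ := IsPGroup.iff_card.1 hIp
  -- Schur–Zassenhaus: `Inn(P)` is a normal `p`-subgroup of index prime to `p`.
  obtain ⟨H, hH⟩ := Subgroup.exists_right_complement'_of_coprime (N := I) (by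
    rw [hn]
    exact Nat.Coprime.pow_left n (((Fact.out : p.Prime).coprime_iff_not_dvd).2 hidx))
  refine ⟨H.map G.subtype, ?_, ?_⟩
  · rw [Nat.card_congr (H.equivMapOfInjective G.subtype G.subtype_injective).symm.toEquiv,
      ← hH.symm.index_eq_card]
    exact hidx
  · ext Q R φ
    constructor
    · intro hφ
      obtain ⟨α, hα, hαφ⟩ := (h Q).exists_mem_autWhole hφ
      -- The factorization of `α` as conjugation by `q` after `a ∈ H` names the conjugating element
      -- `q a` of the semidirect product.
      obtain ⟨⟨⟨i, q, hq⟩, a⟩, hia⟩ := hH.2 ⟨α, hα⟩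
      let a' : H.map G.subtype := ⟨a, a, a.2, rfl⟩
      refine ⟨SemidirectProduct.inl q * SemidirectProduct.inr a', fun x => ?_⟩
      have h1 : α x = q * (a' : MulAut P) (x : P) * q⁻¹ := by
        have h2 : (i : MulAut P) * (a : MulAut P) = α := congrArg Subtype.val hia
        rw [← h2, ← show MulAut.conj q = (i : MulAut P) from hq]
        rfl
      rw [hαφ, h1, map_mul, map_mul, map_inv]
      change _ * SemidirectProduct.inl ((H.map G.subtype).subtype a' x) * _ = _
      rw [SemidirectProduct.inl_aut, mul_inv_rev]
      simp only [mul_assoc, map_inv]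
    · rintro ⟨g, hg⟩
      obtain ⟨a, -, ha⟩ := g.right.2
      have hmem : MulAut.conj g.left * (g.right : MulAut P) ∈ G :=
        mul_mem (F.conj_mem_autWhole _) (ha ▸ a.2)
      refine F.mem_hom_of_mem_autWhole hmem fun x => ?_
      apply SemidirectProduct.inl_injective (φ := (H.map G.subtype).subtype)
      rw [hg, MulAut.mul_apply, MulAut.conj_apply, map_mul, map_mul, map_inv]
      change _ = _ * SemidirectProduct.inl ((H.map G.subtype).subtype g.right x) * _
      rw [SemidirectProduct.inl_aut]
      conv_lhs => rw [← SemidirectProduct.inl_left_mul_inr_right g]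
      rw [mul_inv_rev]
      simp only [mul_assoc, map_inv]

end FusionSystem

theorem theoremt (p : ℕ) [Fact p.Prime] (hp : p ≠ 2) (P : Type*) [Group P] [Finite P]
    (hP : IsPGroup p P) (hmeta : IsMetacyclic P) :
    (∀ F : FusionSystem P, F.IsSaturated p → F = F.normalizer (⊤ : Subgroup P)) ∧
      IsResistant p P :=
  ⟨fun _ hF => FusionSystem.eq_normalizer_top (hF.extendsFrom hP hp hmeta),
    fun _ hF => hF.exists_eq_ofEmbedding hP (hF.extendsFrom hP hp hmeta)⟩
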